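/- Let $A\in\mathbb R^{n\times n}$ ($n\ge 1$) be a symmetric matrix with eigenvalues $a_{\max}=a_1\ge a_2\ge\dots\ge a_n=a_{\min}$ (counted with multiplicity). If $A$ is not a multiple of the identity, let $$\gamma=\frac{a_{\max}-a'}{a_{\max}-a_{\min}},\qquad \operatorname{srk}(\nu)=\sum_{i=1}^n\Big(\frac{a_i-a_{\min}}{a_{\max}-a_{\min}}\Big)^{2\nu}\quad(\nu\ge 0),$$ where $a'$ is the largest eigenvalue strictly smaller than $a_{\max}$ and $0^0=1$; if $A$ is a multiple of the identity, let $\gamma=0$ and $\operatorname{srk}(\nu)=0$. Let $\ell\ge 1$, and let $\Omega\in\mathbb R^{n\times\ell}$ be a random matrix whose entries are independent normal random variables with mean $0$ and variance $1$. Let $q=q_1+q_2$ with integers $q_1,q_2\ge 0$. Let $K_q$ be the range of the matrix $[\,\Omega\ \ A\Omega\ \ A^2\Omega\ \cdots\ A^q\Omega\,]\in\mathbb R^{n\times(q+1)\ell}$, and define $$\xi=\max_{0\ne v\in K_q}\frac{v^*Av}{v^*v},\qquad \mathrm{err}=\frac{a_{\max}-\xi}{a_{\max}-a_{\min}},$$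 where $\xi=0$ if $K_q=\{0\}$ (an event of probability zero) and $\mathrm{err}=0$ if $a_{\max}=a_{\min}$. 1. For every $\varepsilon\in(0,1]$, $$\mathbb P\{\mathrm{err}\ge\varepsilon\}\le \min\Big\{1,\ \sqrt2\,\Big[\frac{8\operatorname{srk}(q_1)}{\varepsilon}\,e^{-4q_2\sqrt\gamma}\Big]^{\ell/2}\Big\}.$$ 2. Put $F=4\operatorname{srk}(q_1)\,e^{-4q_2\sqrt\gamma}$. The random variable $\mathrm{err}$ is integrable, and $$\mathbb E\,\mathrm{err}\le\frac{F}{(\ell-2)+F}\quad(\ell\ge 3),\qquad \mathbb E\,\mathrm{err}\le\frac F2\log\Big(1+\frac2F\Big)\quad(\ell=2),\qquad \mathbb E\,\mathrm{err}\le\min\{1,\sqrt{2\pi F}\}\quad(\ell=1),$$ where, for $\ell=2$ and $F=0$, the right-hand side is read as $0$. -/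

import Mathlib

open MeasureTheory ProbabilityTheory

namespace BlockKrylov

noncomputable section

/-! ### The eigenvalue estimate -/

/-- The block Krylov matrix `[B, A B, A ^ 2 B, …, A ^ q B]`, of size `n × (q + 1) ℓ`.
The column with index `(k, j)` is the `j`-th column of `A ^ k * B`. -/
def krylovMatrix {n ℓ : ℕ} (A : Matrix (Fin n) (Fin n) ℝ) (B : Matrix (Fin n) (Fin ℓ) ℝ)
    (q : ℕ) : Matrix (Fin n) (Fin (q + 1) × Fin ℓ) ℝ :=
  Matrix.of fun i p => (A ^ (p.1 : ℕ) * B) i p.2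

/-- The block Krylov subspace: the range (column space) of the block Krylov matrix. -/
def krylovSubspace {n ℓ : ℕ} (A : Matrix (Fin n) (Fin n) ℝ) (B : Matrix (Fin n) (Fin ℓ) ℝ)
    (q : ℕ) : Submodule ℝ (Fin n → ℝ) :=
  LinearMap.range (krylovMatrix A B q).mulVecLin

/-- The Rayleigh quotient `(v* A v) / (v* v)`. -/
def rayleigh {n : ℕ} (A : Matrix (Fin n) (Fin n) ℝ) (v : Fin n → ℝ) : ℝ :=
  (v ⬝ᵥ A.mulVec v) / (v ⬝ᵥ v)

/-- The block Krylov estimate of the maximum eigenvalue: the maximum of the Rayleigh quotient over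
the nonzero vectors of the block Krylov subspace, and `0` if there are none (`0 / 0 = 0`). The
maximum is attained, since the unit sphere of the subspace is compact. -/
def maxEigEstimate {n ℓ : ℕ} (A : Matrix (Fin n) (Fin n) ℝ) (B : Matrix (Fin n) (Fin ℓ) ℝ)
    (q : ℕ) : ℝ :=
  sSup {r : ℝ | ∃ v ∈ krylovSubspace A B q, v ≠ 0 ∧ r = rayleigh A v}

/-! ### Spectral features of a real symmetric matrix

Over `ℝ`, `Matrix.IsHermitian` means symmetric; `hA.eigenvalues` lists the eigenvalues with
multiplicity. -/

/-- The largest eigenvalue. -/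
def eigMax {n : ℕ} {A : Matrix (Fin n) (Fin n) ℝ} (hA : A.IsHermitian) : ℝ :=
  ⨆ i, hA.eigenvalues i

/-- The smallest eigenvalue. -/
def eigMin {n : ℕ} {A : Matrix (Fin n) (Fin n) ℝ} (hA : A.IsHermitian) : ℝ :=
  ⨅ i, hA.eigenvalues i

open Classical in
/-- The relative spectral gap: the distance from the largest eigenvalue to the next distinct one,
divided by the spectral range; `0` for a multiple of the identity. -/
def spectralGap {n : ℕ} {A : Matrix (Fin n) (Fin n) ℝ} (hA : A.IsHermitian) : ℝ :=
  if eigMax hA = eigMin hA then 0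
  else (eigMax hA - sSup {t : ℝ | (∃ i, hA.eigenvalues i = t) ∧ t < eigMax hA}) /
    (eigMax hA - eigMin hA)

open Classical in
/-- The `ν`-stable rank `∑ i, ((a i - a_min) / (a_max - a_min)) ^ (2 ν)` (with `0 ^ 0 = 1`);
`0` for a multiple of the identity. -/
def stableRank {n : ℕ} {A : Matrix (Fin n) (Fin n) ℝ} (hA : A.IsHermitian) (ν : ℝ) : ℝ :=
  if eigMax hA = eigMin hA then 0
  else ∑ i, ((hA.eigenvalues i - eigMin hA) / (eigMax hA - eigMin hA)) ^ (2 * ν)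

/-- The error of an estimate `ξ` of the largest eigenvalue, relative to the spectral range
(with `0 / 0 = 0`). -/
def relErr {n : ℕ} {A : Matrix (Fin n) (Fin n) ℝ} (hA : A.IsHermitian) (ξ : ℝ) : ℝ :=
  (eigMax hA - ξ) / (eigMax hA - eigMin hA)

/-! ### The random test matrix -/

/-- A standard normal random matrix: its entries are independent Gaussian random variables with
mean zero and variance one. -/
structure IsStandardNormal {S : Type*} [MeasurableSpace S] {n ℓ : ℕ}
    (W : S → Matrix (Fin n) (Fin ℓ) ℝ) (P : Measure S) : Prop where
  indep : iIndepFun (fun (p : Fin n × Fin ℓ) (s : S) => W s p.1 p.2) P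
  law : ∀ i j, HasLaw (fun s => W s i j) (gaussianReal 0 1) P

end

end BlockKrylov

/-!
Write `M i j` for the coordinates of the columns of the test matrix `W` in an orthonormal eigenbasis
of `A`. By rotational invariance `M` is again a standard normal matrix (`hasLaw_eigCoord`). Let `i₀`
be the index of an eigenvector for the largest eigenvalue and let `ω` be the row `M i₀`.

For every polynomial `p` of degree at most `q`, the vector `p(A) W ω` lies in the Krylov space, and
its eigencoordinates are `p (a i) * ⟨M i, ω⟩`. The polynomial is chosen as `x ^ q₁ * ψ x` in the
variable `x = (a - a_min) / (a_max - a_min)`, where `ψ` is a Chebyshev polynomial of degree `q₂`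
that is at most `1` in absolute value on `[0, 1 - γ]` and at least `exp (2 q₂ √γ) / 2` at `1`
(`exists_filter`). Its Rayleigh quotient bounds the error by `Y / (X + Y)`, where `X = ‖ω‖ ^ 2` and
`Y = ∑ d i * g i ^ 2` with `g i = ⟨M i, ω⟩ / ‖ω‖` and weights `d i ≥ 0` that sum to at most `F`
(`relErr_le_of_filter`, `exists_surrogate`). Since the test vector is built from the row `ω`, which
is independent of all other rows, the `g i` are independent standard normal variables and are
independent of `X`, which is chi-squared with `ℓ` degrees of freedom (`lintegral_pairings`).

The tail bound is the Laplace transform method for the event `X ≤ Y / ε`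
(`lintegral_exp_surrogate_le`). For the mean, Jensen's inequality, conditionally on `ω`, replaces `Y`
by `F` (`lintegral_surrogate_le`), and `F / (X + F)` is integrated for each `ℓ`: a second application
of Jensen's inequality, in the variable `1 / X` whose mean is `1 / (ℓ - 2)`, for `ℓ ≥ 3`; an
explicit antiderivative for `ℓ = 2`; and a Gamma integral for `ℓ = 1`. These rest on the formula
`E (1 / Y) = ∫ E exp (-t Y) dt` (`lintegral_one_div_eq_laplace`).
-/

namespace BlockKrylov

/-! ### The Chebyshev filter -/

lemma le_artanh {x : ℝ} (h₀ : 0 ≤ x) (h₁ : x < 1) : x ≤ Real.artanh x := by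
  have hy : 0 ≤ Real.artanh x := Real.artanh_nonneg h₀
  have hx : x = Real.tanh (Real.artanh x) := (Real.tanh_artanh ⟨by linarith, h₁⟩).symm
  set y := Real.artanh x
  rw [hx, Real.tanh_eq_sinh_div_cosh, div_le_iff₀ (Real.cosh_pos y)]
  -- `y * cosh y - sinh y` vanishes at `0` and has derivative `y * sinh y ≥ 0`.
  have hmono : MonotoneOn (fun t : ℝ => t * Real.cosh t - Real.sinh t) (Set.Ici 0) := by
    refine monotoneOn_of_hasDerivWithinAt_nonneg (f' := fun t => t * Real.sinh t)
      (convex_Ici 0) (by fun_prop) (fun t _ => ?_) (fun t ht => ?_)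
    · have := ((hasDerivAt_id t).mul (Real.hasDerivAt_cosh t)).sub (Real.hasDerivAt_sinh t)
      refine (this.congr_deriv ?_).hasDerivWithinAt
      simp
    · have ht' : 0 < t := by simpa using ht
      exact mul_nonneg ht'.le (Real.sinh_nonneg_iff.2 ht'.le)
  have := hmono (Set.mem_Ici.2 le_rfl) (Set.mem_Ici.2 hy) hy
  simp at this
  linarith

open Polynomial in
/-- For `γ < 1`, the Chebyshev polynomial `T_q` is composed with the affine map that takes
`[0, 1 - γ]` to `[-1, 1]`, and it grows like `cosh (q θ)` at `1`. For `γ = 1` the interval is the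
point `0` and a multiple of `x` will do. -/
lemma exists_filter {γ : ℝ} (h₀ : 0 < γ) (h₁ : γ ≤ 1) (q : ℕ) :
    ∃ ψ : ℝ[X], ψ.natDegree ≤ q ∧ (∀ s ∈ Set.Icc 0 (1 - γ), |ψ.eval s| ≤ 1) ∧
      Real.exp (2 * q * √γ) / 2 ≤ ψ.eval 1 := by
  rcases h₁.eq_or_lt with rfl | h₁
  · rcases Nat.eq_zero_or_pos q with rfl | hq
    · exact ⟨1, by simp, by simp, by norm_num⟩
    · refine ⟨C (Real.exp (2 * q) / 2) * X, ?_, ?_, by simp⟩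
      · exact le_trans (by compute_degree) hq
      · rintro s ⟨hs, hs'⟩
        have : s = 0 := le_antisymm (by simpa using hs') hs
        simp [this]
  · have hγ : 0 < 1 - γ := by linarith
    refine ⟨(Chebyshev.T ℝ q).comp (C (2 / (1 - γ)) * X - 1), ?_, ?_, ?_⟩
    · rw [natDegree_comp]
      have h2 : (C (2 / (1 - γ)) * X - 1 : ℝ[X]).natDegree ≤ 1 := by compute_degree
      calc _ ≤ q * 1 := Nat.mul_le_mul (by simp [Chebyshev.natDegree_T]) h2
        _ = q := mul_one q
    · rintro s ⟨hs, hs'⟩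
      rw [eval_comp]
      apply Chebyshev.abs_eval_T_real_le_one
      simp only [eval_sub, eval_mul, eval_C, eval_X, eval_one]
      have h3 : 2 / (1 - γ) * s ≤ 2 := by
        rw [div_mul_eq_mul_div, div_le_iff₀ hγ]; linarith
      have h4 : 0 ≤ 2 / (1 - γ) * s := by positivity
      rw [abs_le]; constructor <;> linarith
    · have hx0 : 0 ≤ √γ := Real.sqrt_nonneg γ
      have hx1 : √γ < 1 := by rw [Real.sqrt_lt' one_pos]; simpa using h₁
      -- The image of `1` is `cosh (2 artanh √γ)`.
      have harg : 2 / (1 - γ) - 1 = Real.cosh (2 * Real.artanh √γ) := by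
        rw [Real.cosh_two_mul, Real.sinh_sq, Real.cosh_artanh ⟨by linarith, hx1⟩, div_pow,
          Real.sq_sqrt h₀.le, Real.sq_sqrt hγ.le]
        ring
      rw [eval_comp]
      simp only [eval_sub, eval_mul, eval_C, eval_X, eval_one, mul_one]
      rw [harg, Chebyshev.T_real_cosh, Real.cosh_eq]
      have h5 : Real.exp (2 * q * √γ) ≤ Real.exp (((q : ℤ) : ℝ) * (2 * Real.artanh √γ)) := by
        apply Real.exp_le_exp.2
        have := mul_le_mul_of_nonneg_left (le_artanh hx0 hx1) (Nat.cast_nonneg (α := ℝ) q)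
        push_cast
        linarith
      have h6 := Real.exp_pos (-(((q : ℤ) : ℝ) * (2 * Real.artanh √γ)))
      linarith

/-! ### Scalar inequalities -/

/-- The concave function `y ↦ y / (x + y)` lies below its tangent at `y = c`. -/
lemma div_add_le_tangent {x y c : ℝ} (hx : 0 < x) (hy : 0 ≤ y) (hc : 0 ≤ c) :
    y / (x + y) ≤ (c ^ 2 + x * y) / (x + c) ^ 2 := by
  rw [div_le_div_iff₀ (by positivity) (by positivity)]
  nlinarith [mul_nonneg hx.le (sq_nonneg (y - c))]

/-- The Weierstrass product inequality. -/
lemma one_sub_sum_le_prod_one_sub {ι : Type*} (s : Finset ι) (x : ι → ℝ) (h₀ : ∀ i ∈ s, 0 ≤ x i)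
    (h₁ : ∀ i ∈ s, x i ≤ 1) : 1 - ∑ i ∈ s, x i ≤ ∏ i ∈ s, (1 - x i) := by
  classical
  induction s using Finset.induction_on with
  | empty => simp
  | insert i s hi ih =>
    rw [Finset.sum_insert hi, Finset.prod_insert hi]
    have hs := ih (fun j hj => h₀ j (Finset.mem_insert_of_mem hj))
      (fun j hj => h₁ j (Finset.mem_insert_of_mem hj))
    have h1 := h₁ i (Finset.mem_insert_self _ _)
    have h0 := h₀ i (Finset.mem_insert_self _ _)
    have hsum : 0 ≤ ∑ j ∈ s, x j :=
      Finset.sum_nonneg fun j hj => h₀ j (Finset.mem_insert_of_mem hj)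
    nlinarith [mul_le_mul_of_nonneg_left hs (sub_nonneg.2 h1), mul_nonneg h0 hsum]

/-! ### Standard normal vectors and matrices -/

/-- The law of a standard normal vector with coordinates indexed by `ι`. -/
noncomputable abbrev stdNormal (ι : Type*) [Fintype ι] : Measure (ι → ℝ) :=
  Measure.pi fun _ => gaussianReal 0 1

/-- The law of a standard normal matrix, as a family of independent rows. -/
noncomputable abbrev stdNormalMatrix (ι κ : Type*) [Fintype ι] [Fintype κ] :
    Measure (ι → κ → ℝ) :=
  Measure.pi fun _ => stdNormal κ

section Law

variable {Ω ι κ : Type*} [MeasurableSpace Ω] [Fintype ι] [Fintype κ] {μ : Measure Ω}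

lemma hasLaw_stdNormalMatrix [IsProbabilityMeasure μ] {X : ι → κ → Ω → ℝ}
    (hind : iIndepFun (fun (p : ι × κ) => X p.1 p.2) μ)
    (hlaw : ∀ i j, HasLaw (X i j) (gaussianReal 0 1) μ) :
    HasLaw (fun ω i j => X i j ω) (stdNormalMatrix ι κ) μ := by
  have hm : ∀ p : ι × κ, AEMeasurable (X p.1 p.2) μ := fun p => (hlaw _ _).aemeasurable
  refine ⟨by fun_prop, ?_⟩
  have h1 := (iIndepFun_iff_map_fun_eq_pi_map hm).1 hind
  simp only [(hlaw _ _).map_eq] at h1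
  have h2 := Measure.infinitePi_map_curry (X := ℝ) (fun (_ : ι) (_ : κ) => gaussianReal 0 1)
  simp only [Measure.infinitePi_eq_pi] at h2
  rw [← h1, AEMeasurable.map_map_of_aemeasurable (by fun_prop) (by fun_prop)] at h2
  exact h2

lemma iIndepFun_entries_stdNormalMatrix :
    iIndepFun (fun (p : ι × κ) (M : ι → κ → ℝ) => M p.1 p.2) (stdNormalMatrix ι κ) := by
  rw [iIndepFun_iff_map_fun_eq_pi_map fun p => Measurable.aemeasurable (by fun_prop)]
  have h2 := Measure.infinitePi_map_curry_symm (X := ℝ) (fun (_ : ι) (_ : κ) => gaussianReal 0 1)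
  simp only [Measure.infinitePi_eq_pi] at h2
  have h3 : ∀ p : ι × κ, (stdNormalMatrix ι κ).map (fun M => M p.1 p.2) = gaussianReal 0 1 :=
    fun p => ((measurePreserving_eval (fun _ : κ => gaussianReal 0 1) p.2).comp
      (measurePreserving_eval (fun _ : ι => stdNormal κ) p.1)).map_eq
  simp only [h3]
  exact h2

lemma measurePreserving_transpose :
    MeasurePreserving (fun (M : ι → κ → ℝ) j i => M i j) (stdNormalMatrix ι κ)
      (stdNormalMatrix κ ι) := by
  have h := hasLaw_stdNormalMatrix (X := fun (j : κ) (i : ι) (M : ι → κ → ℝ) => M i j)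
    (μ := stdNormalMatrix ι κ)
    ((iIndepFun_entries_stdNormalMatrix (ι := ι) (κ := κ)).precomp
      (g := Prod.swap) Prod.swap_injective)
    (fun j i => ⟨Measurable.aemeasurable (by fun_prop),
      ((measurePreserving_eval (fun _ : κ => gaussianReal 0 1) j).comp
      (measurePreserving_eval (fun _ : ι => stdNormal κ) i)).map_eq⟩)
  exact ⟨by fun_prop, h.map_eq⟩

/-- Rotational invariance: the coordinates of a standard normal vector in any orthonormal basis
form a standard normal vector. -/
lemma measurePreserving_repr (b : OrthonormalBasis ι ℝ (EuclideanSpace ℝ ι)) :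
    MeasurePreserving (fun (x : ι → ℝ) i => b i ⬝ᵥ x) (stdNormal ι) (stdNormal ι) := by
  refine ⟨by unfold dotProduct; fun_prop, ?_⟩
  have h1 := stdGaussian_map b.repr
  rw [← map_pi_eq_stdGaussian, Measure.map_map (by fun_prop) (by fun_prop)] at h1
  have h2 := congrArg (Measure.map (WithLp.ofLp)) h1
  rw [Measure.map_map (by fun_prop) (by fun_prop),
    Measure.map_map (by fun_prop) (by fun_prop)] at h2
  have h3 : (WithLp.ofLp ∘ WithLp.toLp 2 : (ι → ℝ) → ι → ℝ) = id := rfl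
  rw [h3, Measure.map_id] at h2
  convert h2 using 2
  ext x i
  simp [b.repr_apply_apply, PiLp.inner_apply, dotProduct, mul_comm]

/-- A standard normal matrix stays standard normal when it is expressed in another orthonormal
basis of the column space. -/
lemma measurePreserving_repr_matrix (b : OrthonormalBasis ι ℝ (EuclideanSpace ℝ ι)) :
    MeasurePreserving (fun (M : ι → κ → ℝ) i j => b i ⬝ᵥ fun k => M k j)
      (stdNormalMatrix ι κ) (stdNormalMatrix ι κ) :=
  measurePreserving_transpose.comp ((measurePreserving_pi (fun _ : κ => stdNormal ι)
    (fun _ : κ => stdNormal ι) fun _ => measurePreserving_repr b).comp measurePreserving_transpose)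

/-- The pairing of a standard normal vector with a unit vector is standard normal. -/
lemma measurePreserving_dotProduct {u : κ → ℝ} (hu : u ⬝ᵥ u = 1) :
    MeasurePreserving (fun x : κ → ℝ => x ⬝ᵥ u) (stdNormal κ) (gaussianReal 0 1) := by
  refine ⟨by unfold dotProduct; fun_prop, ?_⟩
  let L : StrongDual ℝ (EuclideanSpace ℝ κ) := innerSL ℝ (WithLp.toLp 2 u)
  have hL : ‖L‖ ^ 2 = 1 := by
    simp only [L, innerSL_apply_norm]
    rw [EuclideanSpace.real_norm_sq_eq]
    simpa [dotProduct, sq] using hu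
  have h := IsGaussian.map_eq_gaussianReal (μ := stdGaussian (EuclideanSpace ℝ κ)) L
  rw [variance_dual_stdGaussian, hL, integral_strongDual_stdGaussian,
    ← map_pi_eq_stdGaussian, Measure.map_map (by fun_prop) (by fun_prop)] at h
  convert h using 2
  · ext x
    simp [L, PiLp.inner_apply, dotProduct]
  · simp

end Law

lemma ae_dotProduct_self_pos (κ : Type*) [Fintype κ] [Nonempty κ] :
    ∀ᵐ ω ∂stdNormal κ, 0 < ω ⬝ᵥ ω := by
  obtain ⟨j⟩ := ‹Nonempty κ›
  have h0 : ∀ᵐ t ∂gaussianReal 0 1, t ≠ 0 := by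
    have := nullSingletonClass_gaussianReal (μ := 0) (v := 1) one_ne_zero
    simp [ae_iff]
  filter_upwards [(measurePreserving_eval (fun _ : κ => gaussianReal 0 1)
    j).quasiMeasurePreserving.ae h0] with ω hω
  refine lt_of_le_of_ne (Finset.sum_nonneg fun i _ => mul_self_nonneg _) fun h => hω ?_
  rw [dotProduct_self_eq_zero.1 h.symm]
  rfl

section Resample

variable {ι κ : Type*} [Fintype ι] [Fintype κ] [DecidableEq ι]

/-- Replacing one row of a standard normal matrix by an independent standard normal vector does
not change the law of the matrix. -/
lemma measurePreserving_update (i₀ : ι) :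
    MeasurePreserving (fun p : (κ → ℝ) × (ι → κ → ℝ) => Function.update p.2 i₀ p.1)
      ((stdNormal κ).prod (stdNormalMatrix ι κ)) (stdNormalMatrix ι κ) := by
  have hm : Measurable (fun p : (κ → ℝ) × (ι → κ → ℝ) => Function.update p.2 i₀ p.1) := by
    refine measurable_pi_lambda _ fun i => ?_
    rcases eq_or_ne i i₀ with rfl | hi
    · simpa using measurable_fst
    · simp only [Function.update_of_ne hi]; fun_prop
  refine ⟨hm, (Measure.pi_eq fun s hs => ?_).symm⟩
  have hpre : (fun p : (κ → ℝ) × (ι → κ → ℝ) => Function.update p.2 i₀ p.1) ⁻¹' Set.univ.pi s =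
      s i₀ ×ˢ Set.univ.pi (Function.update s i₀ Set.univ) := by
    ext p
    simp only [Set.mem_preimage, Set.mem_univ_pi, Set.mem_prod]
    constructor
    · intro h
      refine ⟨by simpa using h i₀, fun i => ?_⟩
      rcases eq_or_ne i i₀ with rfl | hi
      · simp
      · simpa [hi] using h i
    · rintro ⟨h0, h⟩ i
      rcases eq_or_ne i i₀ with rfl | hi
      · simpa using h0
      · simpa [hi] using h i
  rw [Measure.map_apply hm (.univ_pi hs), hpre, Measure.prod_prod, Measure.pi_pi,
    ← Finset.mul_prod_erase _ _ (Finset.mem_univ i₀),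
    ← Finset.mul_prod_erase Finset.univ (fun i => stdNormal κ (s i)) (Finset.mem_univ i₀)]
  simp only [Function.update_self, measure_univ, one_mul]
  congr 1
  refine Finset.prod_congr rfl fun i hi => ?_
  rw [Function.update_of_ne (Finset.ne_of_mem_erase hi)]

/-- Let `ω` be the row `i₀` of a standard normal matrix. The pairings of the other rows with the
unit vector `ω / ‖ω‖` are independent standard normal variables, independent of `ω`. The function
`f ω` must not depend on the coordinate `i₀`, where the pairing is `‖ω‖`. -/
lemma lintegral_pairings (i₀ : ι) [Nonempty κ] {f : (κ → ℝ) → (ι → ℝ) → ENNReal}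
    (hf : Measurable (Function.uncurry f))
    (hi₀ : ∀ ω g t, f ω (Function.update g i₀ t) = f ω g) :
    ∫⁻ M, f (M i₀) (fun i => (M i ⬝ᵥ M i₀) / √(M i₀ ⬝ᵥ M i₀)) ∂stdNormalMatrix ι κ =
      ∫⁻ ω, ∫⁻ g, f ω g ∂stdNormal ι ∂stdNormal κ := by
  have hm : Measurable fun M : ι → κ → ℝ =>
      f (M i₀) (fun i => (M i ⬝ᵥ M i₀) / √(M i₀ ⬝ᵥ M i₀)) := by
    refine hf.comp (f := fun M : ι → κ → ℝ =>
      (M i₀, fun i => (M i ⬝ᵥ M i₀) / √(M i₀ ⬝ᵥ M i₀))) ?_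
    unfold dotProduct
    fun_prop
  have hm' : Measurable fun p : (κ → ℝ) × (ι → κ → ℝ) =>
      f (Function.update p.2 i₀ p.1 i₀) (fun i =>
        (Function.update p.2 i₀ p.1 i ⬝ᵥ Function.update p.2 i₀ p.1 i₀) /
          √(Function.update p.2 i₀ p.1 i₀ ⬝ᵥ Function.update p.2 i₀ p.1 i₀)) :=
    hm.comp (measurePreserving_update i₀).measurable
  rw [← (measurePreserving_update i₀).lintegral_comp hm, lintegral_prod _ hm'.aemeasurable]
  refine lintegral_congr_ae ((ae_dotProduct_self_pos κ).mono fun ω hpos => ?_)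
  have hu : (√(ω ⬝ᵥ ω))⁻¹ • ω ⬝ᵥ (√(ω ⬝ᵥ ω))⁻¹ • ω = 1 := by
    rw [smul_dotProduct, dotProduct_smul, smul_eq_mul, smul_eq_mul, ← mul_assoc, ← mul_inv,
      Real.mul_self_sqrt hpos.le, inv_mul_cancel₀ hpos.ne']
  have hmp := measurePreserving_pi (fun _ : ι => stdNormal κ) (fun _ : ι => gaussianReal 0 1)
    fun _ => measurePreserving_dotProduct hu
  have hfω : Measurable (f ω) := hf.comp measurable_prodMk_left
  refine Eq.trans (lintegral_congr fun M => ?_) (hmp.lintegral_comp hfω)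
  dsimp only
  rw [Function.update_self, ← hi₀ ω (fun i => M i ⬝ᵥ (√(ω ⬝ᵥ ω))⁻¹ • ω) (√(ω ⬝ᵥ ω))]
  congr 1
  ext i
  rcases eq_or_ne i i₀ with rfl | hi
  · simp
  · rw [Function.update_of_ne hi, Function.update_of_ne hi, dotProduct_smul, smul_eq_mul]
    ring

end Resample

/-! ### Gaussian and exponential integrals -/

lemma lintegral_exp_mul_sq_gaussianReal {s : ℝ} (hs : s < 1 / 2) :
    ∫⁻ z, ENNReal.ofReal (Real.exp (s * z ^ 2)) ∂gaussianReal 0 1 =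
      ENNReal.ofReal (1 / √(1 - 2 * s)) := by
  have hb : 0 < 1 / 2 - s := by linarith
  rw [gaussianReal_of_var_ne_zero _ one_ne_zero,
    lintegral_withDensity_eq_lintegral_mul _ (measurable_gaussianPDF 0 1) (by fun_prop)]
  have h1 : ∀ z, (gaussianPDF 0 1 * fun z => ENNReal.ofReal (Real.exp (s * z ^ 2))) z =
      ENNReal.ofReal ((√(2 * Real.pi))⁻¹ * Real.exp (-(1 / 2 - s) * z ^ 2)) := by
    intro z
    rw [Pi.mul_apply, gaussianPDF, ← ENNReal.ofReal_mul (gaussianPDFReal_nonneg _ _ _),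
      gaussianPDFReal, mul_assoc, ← Real.exp_add]
    congr 2
    · simp
    · congr 1
      simp
      ring
  simp only [h1]
  rw [← ofReal_integral_eq_lintegral_ofReal ((integrable_exp_neg_mul_sq hb).const_mul _)
    (ae_of_all _ fun z => by positivity), integral_const_mul, integral_gaussian]
  have h2 : Real.pi / (1 / 2 - s) = 2 * Real.pi / (1 - 2 * s) := by
    rw [div_eq_div_iff hb.ne' (by linarith)]
    ring
  have h3 : √(2 * Real.pi) ≠ 0 := by positivity
  rw [h2, Real.sqrt_div (by positivity)]
  field_simp

lemma lintegral_sq_gaussianReal :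
    ∫⁻ z, ENNReal.ofReal (z ^ 2) ∂gaussianReal 0 1 = 1 := by
  have h := variance_id_gaussianReal (μ := 0) (v := 1)
  rw [variance_eq_integral (by fun_prop)] at h
  simp only [id_eq, integral_id_gaussianReal, sub_zero, NNReal.coe_one] at h
  rw [← ofReal_integral_eq_lintegral_ofReal
    (show Integrable (fun z : ℝ => z ^ 2) (gaussianReal 0 1) from
      (memLp_id_gaussianReal (μ := 0) (v := 1) 2).integrable_sq)
    (ae_of_all _ fun z => sq_nonneg _)]
  simp [h]

lemma lintegral_prod_stdNormal {ι : Type*} [Fintype ι] {f : ι → ℝ → ENNReal}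
    (hf : ∀ i, Measurable (f i)) :
    ∫⁻ x, ∏ i, f i (x i) ∂stdNormal ι = ∏ i, ∫⁻ z, f i z ∂gaussianReal 0 1 := by
  have hind := iIndepFun_pi (μ := fun _ : ι => gaussianReal 0 1) (X := f)
    fun i => (hf i).aemeasurable
  refine (lintegral_prod_eq_prod_lintegral_of_indepFun Finset.univ
    (fun i (x : ι → ℝ) => f i (x i)) hind fun i => (hf i).comp (measurable_pi_apply i)).trans ?_
  exact Finset.prod_congr rfl fun i _ =>
    (measurePreserving_eval (fun _ : ι => gaussianReal 0 1) i).lintegral_comp (hf i)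

lemma lintegral_exp_sum_sq_stdNormal {ι : Type*} [Fintype ι] {c : ι → ℝ} (hc : ∀ i, c i < 1 / 2) :
    ∫⁻ x, ENNReal.ofReal (Real.exp (∑ i, c i * x i ^ 2)) ∂stdNormal ι =
      ENNReal.ofReal (∏ i, 1 / √(1 - 2 * c i)) := by
  have h : ∀ x : ι → ℝ, ENNReal.ofReal (Real.exp (∑ i, c i * x i ^ 2)) =
      ∏ i, ENNReal.ofReal (Real.exp (c i * x i ^ 2)) := fun x => by
    rw [Real.exp_sum, ENNReal.ofReal_prod_of_nonneg fun i _ => (Real.exp_pos _).le]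
  simp only [h]
  rw [lintegral_prod_stdNormal (f := fun i z => ENNReal.ofReal (Real.exp (c i * z ^ 2)))
    (fun i => by fun_prop), ENNReal.ofReal_prod_of_nonneg fun i _ => by positivity]
  exact Finset.prod_congr rfl fun i _ => lintegral_exp_mul_sq_gaussianReal (hc i)

/-- The Laplace transform of the chi-squared distribution. -/
lemma lintegral_exp_neg_mul_dotProduct {κ : Type*} [Fintype κ] {t : ℝ} (ht : 0 ≤ t) :
    ∫⁻ ω, ENNReal.ofReal (Real.exp (-(t * (ω ⬝ᵥ ω)))) ∂stdNormal κ =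
      ENNReal.ofReal ((1 / √(1 + 2 * t)) ^ Fintype.card κ) := by
  have h := lintegral_exp_sum_sq_stdNormal (ι := κ) (c := fun _ => -t) (fun _ => by linarith)
  simp only [Finset.prod_const, Finset.card_univ, mul_neg, sub_neg_eq_add] at h
  rw [← h]
  refine lintegral_congr fun ω => ?_
  congr 2
  simp only [dotProduct, Finset.mul_sum, ← Finset.sum_neg_distrib]
  exact Finset.sum_congr rfl fun i _ => by ring

lemma lintegral_exp_neg_mul_Ioi {a : ℝ} (ha : 0 < a) :
    ∫⁻ t in Set.Ioi (0 : ℝ), ENNReal.ofReal (Real.exp (-(t * a))) = ENNReal.ofReal (1 / a) := by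
  have hint := integrableOn_exp_mul_Ioi (a := -a) (by linarith) 0
  have hval := integral_exp_mul_Ioi (a := -a) (by linarith) 0
  have h : ∀ t : ℝ, -(t * a) = -a * t := fun t => by ring
  simp only [h]
  rw [← ofReal_integral_eq_lintegral_ofReal hint (ae_of_all _ fun t => (Real.exp_pos _).le), hval]
  simp

/-- The mean of `1 / Y` is the integral of the Laplace transform of `Y`. -/
lemma lintegral_one_div_eq_laplace {Ω : Type*} [MeasurableSpace Ω] {μ : Measure Ω} [SFinite μ]
    {Y : Ω → ℝ} (hY : Measurable Y) (hpos : ∀ᵐ ω ∂μ, 0 < Y ω) :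
    ∫⁻ ω, ENNReal.ofReal (1 / Y ω) ∂μ =
      ∫⁻ t in Set.Ioi (0 : ℝ), ∫⁻ ω, ENNReal.ofReal (Real.exp (-(t * Y ω))) ∂μ := by
  rw [lintegral_lintegral_swap (by fun_prop)]
  exact lintegral_congr_ae (hpos.mono fun ω hω => (lintegral_exp_neg_mul_Ioi hω).symm)

/-! ### Moments of the chi-squared distribution -/

lemma measurable_dotProduct_self {κ : Type*} [Fintype κ] :
    Measurable fun ω : κ → ℝ => ω ⬝ᵥ ω := by
  unfold dotProduct
  fun_prop

/-- The inverse moment of the chi-squared distribution is `1 / (ℓ - 2)`. -/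
lemma lintegral_inv_chiSq {κ : Type*} [Fintype κ] (hκ : 3 ≤ Fintype.card κ) :
    ∫⁻ ω, ENNReal.ofReal (1 / (ω ⬝ᵥ ω)) ∂stdNormal κ =
      ENNReal.ofReal (1 / ((Fintype.card κ : ℝ) - 2)) := by
  have : Nonempty κ := Fintype.card_pos_iff.1 (by omega)
  have hℓ : (3 : ℝ) ≤ Fintype.card κ := by exact_mod_cast hκ
  set ℓ := Fintype.card κ with hℓdef
  rw [lintegral_one_div_eq_laplace measurable_dotProduct_self (ae_dotProduct_self_pos κ)]
  have h1 : ∀ t ∈ Set.Ioi (0 : ℝ),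
      ∫⁻ ω, ENNReal.ofReal (Real.exp (-(t * (ω ⬝ᵥ ω)))) ∂stdNormal κ =
        ENNReal.ofReal ((1 + 2 * t) ^ (-(ℓ : ℝ) / 2)) := by
    intro t ht
    have ht' : 0 < 1 + 2 * t := by have := Set.mem_Ioi.1 ht; linarith
    rw [lintegral_exp_neg_mul_dotProduct (le_of_lt ht), one_div, Real.sqrt_eq_rpow,
      ← Real.rpow_neg ht'.le, ← Real.rpow_natCast, ← Real.rpow_mul ht'.le]
    congr 2
    ring
  rw [setLIntegral_congr_fun measurableSet_Ioi h1]
  -- an antiderivative of the integrand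
  let G : ℝ → ℝ := fun t => -(1 / ((ℓ : ℝ) - 2)) * (1 + 2 * t) ^ (1 - (ℓ : ℝ) / 2)
  have hG : ∀ t ∈ Set.Ici (0 : ℝ), HasDerivAt G ((1 + 2 * t) ^ (-(ℓ : ℝ) / 2)) t := by
    intro t ht
    have ht' : 0 < 1 + 2 * t := by have := Set.mem_Ici.1 ht; linarith
    have hlin : HasDerivAt (fun t : ℝ => 1 + 2 * t) 2 t := by
      simpa using ((hasDerivAt_id t).const_mul 2).const_add 1
    have := (hlin.rpow_const (p := 1 - (ℓ : ℝ) / 2) (Or.inl ht'.ne')).const_mul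
      (-(1 / ((ℓ : ℝ) - 2)))
    refine this.congr_deriv ?_
    have h2 : (ℓ : ℝ) - 2 ≠ 0 := by linarith
    have h3 : (1 - (ℓ : ℝ) / 2 - 1) = -(ℓ : ℝ) / 2 := by ring
    rw [h3]
    field_simp
    ring
  have hlim : Filter.Tendsto G Filter.atTop (nhds 0) := by
    have h4 : Filter.Tendsto (fun t : ℝ => 1 + 2 * t) Filter.atTop Filter.atTop :=
      Filter.tendsto_atTop_add_const_left _ _
        (Filter.tendsto_id.const_mul_atTop (by norm_num))
    have h5 := (tendsto_rpow_neg_atTop (y := (ℓ : ℝ) / 2 - 1) (by linarith)).comp h4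
    have h6 := h5.const_mul (-(1 / ((ℓ : ℝ) - 2)))
    rw [mul_zero] at h6
    refine h6.congr fun t => ?_
    simp only [G, Function.comp, neg_sub]
  have hnn : ∀ t ∈ Set.Ioi (0 : ℝ), 0 ≤ (1 + 2 * t) ^ (-(ℓ : ℝ) / 2) := fun t ht => by
    have := Set.mem_Ioi.1 ht; positivity
  have hint := integrableOn_Ioi_deriv_of_nonneg' hG hnn hlim
  have hval := integral_Ioi_of_hasDerivAt_of_nonneg' hG hnn hlim
  rw [← ofReal_integral_eq_lintegral_ofReal hint
    ((ae_restrict_iff' measurableSet_Ioi).2 (ae_of_all _ hnn)), hval]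
  simp [G]

/-- Jensen's inequality for the concave function `y ↦ y / (x + y)`. -/
lemma lintegral_div_add_le {Ω : Type*} [MeasurableSpace Ω] {μ : Measure Ω}
    [IsProbabilityMeasure μ] {Y : Ω → ℝ} (hY : Measurable Y) (hY₀ : ∀ᵐ ω ∂μ, 0 ≤ Y ω) {x c : ℝ}
    (hx : 0 < x) (hc : 0 ≤ c) (hmean : ∫⁻ ω, ENNReal.ofReal (Y ω) ∂μ ≤ ENNReal.ofReal c) :
    ∫⁻ ω, ENNReal.ofReal (Y ω / (x + Y ω)) ∂μ ≤ ENNReal.ofReal (c / (x + c)) := by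
  calc ∫⁻ ω, ENNReal.ofReal (Y ω / (x + Y ω)) ∂μ
      ≤ ∫⁻ ω, (ENNReal.ofReal (c ^ 2 / (x + c) ^ 2) +
          ENNReal.ofReal (x / (x + c) ^ 2) * ENNReal.ofReal (Y ω)) ∂μ := by
        refine lintegral_mono_ae (hY₀.mono fun ω hω => ?_)
        rw [← ENNReal.ofReal_mul (by positivity), ← ENNReal.ofReal_add (by positivity)
          (by positivity)]
        refine ENNReal.ofReal_le_ofReal ((div_add_le_tangent hx hω hc).trans_eq ?_)
        ring
    _ = ENNReal.ofReal (c ^ 2 / (x + c) ^ 2) +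
          ENNReal.ofReal (x / (x + c) ^ 2) * ∫⁻ ω, ENNReal.ofReal (Y ω) ∂μ := by
        rw [lintegral_add_left measurable_const, lintegral_const, measure_univ, mul_one,
          lintegral_const_mul _ (by fun_prop)]
    _ ≤ ENNReal.ofReal (c ^ 2 / (x + c) ^ 2) +
          ENNReal.ofReal (x / (x + c) ^ 2) * ENNReal.ofReal c := by gcongr
    _ = ENNReal.ofReal (c / (x + c)) := by
        rw [← ENNReal.ofReal_mul (by positivity), ← ENNReal.ofReal_add (by positivity)
          (by positivity)]
        congr 1
        have : x + c ≠ 0 := by positivity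
        field_simp
        ring

lemma lintegral_chiSq_of_three_le {κ : Type*} [Fintype κ] (hκ : 3 ≤ Fintype.card κ) {F : ℝ}
    (hF : 0 < F) :
    ∫⁻ ω, ENNReal.ofReal (F / (ω ⬝ᵥ ω + F)) ∂stdNormal κ ≤
      ENNReal.ofReal (F / ((Fintype.card κ : ℝ) - 2 + F)) := by
  have : Nonempty κ := Fintype.card_pos_iff.1 (by omega)
  have hℓ : (0 : ℝ) < (Fintype.card κ : ℝ) - 2 := by
    have : (3 : ℝ) ≤ Fintype.card κ := by exact_mod_cast hκ
    linarith
  have hm : Measurable fun ω : κ → ℝ => F * (1 / (ω ⬝ᵥ ω)) :=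
    (measurable_const.div measurable_dotProduct_self).const_mul F
  have hpos := ae_dotProduct_self_pos κ
  -- As a function of `1 / (ω ⬝ᵥ ω)` the integrand is concave.
  have h := lintegral_div_add_le (μ := stdNormal κ) hm
    (hpos.mono fun ω hω => by positivity) one_pos (c := F * (1 / ((Fintype.card κ : ℝ) - 2)))
    (by positivity) (by
      simp only [ENNReal.ofReal_mul hF.le]
      rw [lintegral_const_mul _ (by
        exact (measurable_const.div measurable_dotProduct_self).ennreal_ofReal),
        lintegral_inv_chiSq hκ])
  calc _ = ∫⁻ ω, ENNReal.ofReal (F * (1 / (ω ⬝ᵥ ω)) / (1 + F * (1 / (ω ⬝ᵥ ω)))) ∂stdNormal κ := by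
        refine lintegral_congr_ae (hpos.mono fun ω hω => ?_)
        dsimp only
        congr 1
        field_simp
    _ ≤ _ := h
    _ = _ := by
        congr 1
        field_simp

lemma lintegral_chiSq_eq_laplace {κ : Type*} [Fintype κ] {F : ℝ} (hF : 0 < F) :
    ∫⁻ ω, ENNReal.ofReal (F / (ω ⬝ᵥ ω + F)) ∂stdNormal κ =
      ENNReal.ofReal F * ∫⁻ t in Set.Ioi (0 : ℝ),
        ENNReal.ofReal (Real.exp (-(t * F))) *
          ENNReal.ofReal ((1 / √(1 + 2 * t)) ^ Fintype.card κ) := by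
  have hm : Measurable fun ω : κ → ℝ => ω ⬝ᵥ ω + F := measurable_dotProduct_self.add_const F
  have hnn : ∀ ω : κ → ℝ, 0 < ω ⬝ᵥ ω + F := fun ω =>
    add_pos_of_nonneg_of_pos (Finset.sum_nonneg fun i _ => mul_self_nonneg _) hF
  have h1 : ∀ ω : κ → ℝ, ENNReal.ofReal (F / (ω ⬝ᵥ ω + F)) =
      ENNReal.ofReal F * ENNReal.ofReal (1 / (ω ⬝ᵥ ω + F)) := fun ω => by
    rw [← ENNReal.ofReal_mul hF.le]; congr 1; ring
  simp only [h1]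
  rw [lintegral_const_mul _ (by fun_prop), lintegral_one_div_eq_laplace hm (ae_of_all _ hnn)]
  congr 1
  refine setLIntegral_congr_fun measurableSet_Ioi fun t ht => ?_
  have h2 : ∀ ω : κ → ℝ, ENNReal.ofReal (Real.exp (-(t * (ω ⬝ᵥ ω + F)))) =
      ENNReal.ofReal (Real.exp (-(t * F))) * ENNReal.ofReal (Real.exp (-(t * (ω ⬝ᵥ ω)))) :=
    fun ω => by
      rw [← ENNReal.ofReal_mul (Real.exp_pos _).le, ← Real.exp_add]; congr 2; ring
  simp only [h2]
  rw [lintegral_const_mul _ (by have := measurable_dotProduct_self (κ := κ); fun_prop),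
    lintegral_exp_neg_mul_dotProduct (le_of_lt ht)]

/-- Here `1 / √(1 + 2 t) ≤ 1 / √t` reduces the Laplace integral to `Γ(1/2)`. -/
lemma lintegral_chiSq_one {κ : Type*} [Fintype κ] (hκ : Fintype.card κ = 1) {F : ℝ} (hF : 0 < F) :
    ∫⁻ ω, ENNReal.ofReal (F / (ω ⬝ᵥ ω + F)) ∂stdNormal κ ≤ ENNReal.ofReal √(2 * Real.pi * F) := by
  rw [lintegral_chiSq_eq_laplace hF, hκ]
  have h1 : ∀ t ∈ Set.Ioi (0 : ℝ), ENNReal.ofReal (Real.exp (-(t * F))) *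
      ENNReal.ofReal ((1 / √(1 + 2 * t)) ^ 1) ≤
        ENNReal.ofReal (t ^ ((1 / 2 : ℝ) - 1) * Real.exp (-(F * t))) := by
    intro t ht
    have ht' : 0 < t := ht
    rw [← ENNReal.ofReal_mul (Real.exp_pos _).le]
    apply ENNReal.ofReal_le_ofReal
    rw [mul_comm, mul_comm F t]
    refine mul_le_mul_of_nonneg_right ?_ (Real.exp_pos _).le
    rw [show (1 / 2 : ℝ) - 1 = -(1 / 2) by norm_num, Real.rpow_neg ht'.le, ← Real.sqrt_eq_rpow,
      pow_one, one_div]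
    exact inv_anti₀ (Real.sqrt_pos.2 ht') (Real.sqrt_le_sqrt (by linarith))
  have hval := Real.integral_rpow_mul_exp_neg_mul_Ioi (a := 1 / 2) (r := F) (by norm_num) hF
  have hpos : 0 < ∫ t in Set.Ioi (0 : ℝ), t ^ ((1 / 2 : ℝ) - 1) * Real.exp (-(F * t)) := by
    rw [hval, Real.Gamma_one_half_eq]; positivity
  have hint : IntegrableOn (fun t : ℝ => t ^ ((1 / 2 : ℝ) - 1) * Real.exp (-(F * t)))
      (Set.Ioi 0) := by
    by_contra h
    exact hpos.ne' (integral_undef h)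
  calc _ ≤ ENNReal.ofReal F * ∫⁻ t in Set.Ioi (0 : ℝ),
        ENNReal.ofReal (t ^ ((1 / 2 : ℝ) - 1) * Real.exp (-(F * t))) := by
        refine mul_le_mul' le_rfl ?_
        exact setLIntegral_mono' measurableSet_Ioi h1
    _ = ENNReal.ofReal (F * ((1 / F) ^ (1 / 2 : ℝ) * √Real.pi)) := by
        rw [← ofReal_integral_eq_lintegral_ofReal hint
          ((ae_restrict_iff' measurableSet_Ioi).2 (ae_of_all _ fun t ht => by
            have := Set.mem_Ioi.1 ht; positivity)), hval, Real.Gamma_one_half_eq,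
          ← ENNReal.ofReal_mul hF.le]
    _ ≤ _ := by
        apply ENNReal.ofReal_le_ofReal
        rw [← Real.sqrt_eq_rpow, ← Real.sqrt_mul (by positivity)]
        apply Real.le_sqrt_of_sq_le
        rw [mul_pow, Real.sq_sqrt (by positivity)]
        have : F ^ 2 * (1 / F * Real.pi) = Real.pi * F := by field_simp
        rw [this]
        nlinarith [mul_pos Real.pi_pos hF]

/-- For `ℓ = 2`, half of `ω ⬝ᵥ ω` is exponentially distributed. With `U = exp (-ω ⬝ᵥ ω / 2)`, which
is uniform on `(0, 1)`, the bound is the mean of `F / (2 (1 - U) + F)`, since `1 - U ≤ -log U`. -/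
lemma lintegral_chiSq_two {κ : Type*} [Fintype κ] (hκ : Fintype.card κ = 2) {F : ℝ} (hF : 0 < F) :
    ∫⁻ ω, ENNReal.ofReal (F / (ω ⬝ᵥ ω + F)) ∂stdNormal κ ≤
      ENNReal.ofReal (F / 2 * Real.log (1 + 2 / F)) := by
  rw [lintegral_chiSq_eq_laplace hF, hκ]
  have h1 : ∀ t ∈ Set.Ioi (0 : ℝ), ENNReal.ofReal (Real.exp (-(t * F))) *
      ENNReal.ofReal ((1 / √(1 + 2 * t)) ^ 2) =
        ∫⁻ x in Set.Ioi (0 : ℝ), ENNReal.ofReal (Real.exp (-x / 2) / 2) *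
          ENNReal.ofReal (Real.exp (-(t * (x + F)))) := by
    intro t ht
    have ht' : 0 < t := ht
    have hx : ∀ x : ℝ, ENNReal.ofReal (Real.exp (-x / 2) / 2) *
          ENNReal.ofReal (Real.exp (-(t * (x + F)))) =
        ENNReal.ofReal (Real.exp (-(t * F)) / 2) *
          ENNReal.ofReal (Real.exp (-(x * (1 / 2 + t)))) := fun x => by
      rw [← ENNReal.ofReal_mul (by positivity), ← ENNReal.ofReal_mul (by positivity),
        div_mul_eq_mul_div, div_mul_eq_mul_div, ← Real.exp_add, ← Real.exp_add]
      congr 3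
      ring
    simp only [hx]
    rw [lintegral_const_mul _ (by fun_prop), lintegral_exp_neg_mul_Ioi (by linarith),
      ← ENNReal.ofReal_mul (by positivity), ← ENNReal.ofReal_mul (by positivity), div_pow,
      Real.sq_sqrt (by linarith)]
    congr 1
    have h2 : 1 + 2 * t ≠ 0 := by linarith
    have h3 : 1 / 2 + t ≠ 0 := by linarith
    field_simp
  rw [setLIntegral_congr_fun measurableSet_Ioi h1, lintegral_lintegral_swap (by fun_prop)]
  let G : ℝ → ℝ := fun x => Real.log (2 * (1 - Real.exp (-x / 2)) + F) / 2
  let g : ℝ → ℝ := fun x => Real.exp (-x / 2) / 2 / (2 * (1 - Real.exp (-x / 2)) + F)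
  have hden : ∀ x ∈ Set.Ici (0 : ℝ), 0 < 2 * (1 - Real.exp (-x / 2)) + F := fun x hx => by
    have h4 : Real.exp (-x / 2) ≤ 1 := Real.exp_le_one_iff.2 (by linarith [Set.mem_Ici.1 hx])
    linarith
  have hG : ∀ x ∈ Set.Ici (0 : ℝ), HasDerivAt G (g x) x := by
    intro x hx
    have he : HasDerivAt (fun x : ℝ => Real.exp (-x / 2)) (Real.exp (-x / 2) * (-1 / 2)) x :=
      (((hasDerivAt_id x).neg).div_const 2).exp
    have h5 := ((((he.const_sub 1).const_mul 2).add_const F).log (hden x hx).ne').div_const 2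
    refine h5.congr_deriv ?_
    simp only [g]
    ring
  have hlim : Filter.Tendsto G Filter.atTop (nhds (Real.log (2 + F) / 2)) := by
    have h6 : Filter.Tendsto (fun x : ℝ => Real.exp (-x / 2)) Filter.atTop (nhds 0) := by
      refine Real.tendsto_exp_atBot.comp ?_
      have := (Filter.tendsto_id (α := ℝ) (x := Filter.atTop)).const_mul_atTop_of_neg
        (r := -(1 / 2)) (by norm_num)
      refine this.congr fun x => ?_
      simp only [id]
      ring
    have h7 := ((h6.const_sub 1).const_mul 2).add_const F
    have h8 := (h7.log (by linarith)).div_const 2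
    simpa using h8
  have hgn : ∀ x ∈ Set.Ioi (0 : ℝ), 0 ≤ g x := fun x hx => by
    have := hden x (Set.mem_Ici.2 (le_of_lt hx))
    simp only [g]
    positivity
  have hint := integrableOn_Ioi_deriv_of_nonneg' hG hgn hlim
  have hval := integral_Ioi_of_hasDerivAt_of_nonneg' hG hgn hlim
  calc _ ≤ ENNReal.ofReal F * ∫⁻ x in Set.Ioi (0 : ℝ), ENNReal.ofReal (g x) := by
        refine mul_le_mul' le_rfl ?_
        refine setLIntegral_mono' measurableSet_Ioi fun x hx => ?_
        have hx' : 0 < x := hx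
        rw [lintegral_const_mul _ (by fun_prop), lintegral_exp_neg_mul_Ioi (by linarith),
          ← ENNReal.ofReal_mul (by positivity), mul_one_div]
        apply ENNReal.ofReal_le_ofReal
        refine div_le_div_of_nonneg_left (by positivity) (hden x (Set.mem_Ici.2 hx'.le)) ?_
        have := Real.add_one_le_exp (-x / 2)
        linarith
    _ = ENNReal.ofReal (F * (Real.log (2 + F) / 2 - G 0)) := by
        rw [← ofReal_integral_eq_lintegral_ofReal hint
          ((ae_restrict_iff' measurableSet_Ioi).2 (ae_of_all _ hgn)), hval,
          ← ENNReal.ofReal_mul hF.le]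
    _ = _ := by
        congr 1
        have h9 : 1 + 2 / F = (2 + F) / F := by field_simp; ring
        rw [h9, Real.log_div (by linarith) hF.ne']
        simp [G]
        ring

/-! ### The surrogate error

The error of the block Krylov method is at most `Y / (X + Y)`, where `X` has a chi-squared
distribution and, independently, `Y = ∑ i, d i * g i ^ 2` with `g` standard normal. -/

section Surrogate

variable {ι κ : Type*} [Fintype ι] [Fintype κ]

lemma lintegral_sum_sq_stdNormal {d : ι → ℝ} (hd : ∀ i, 0 ≤ d i) :
    ∫⁻ g, ENNReal.ofReal (∑ i, d i * g i ^ 2) ∂stdNormal ι = ENNReal.ofReal (∑ i, d i) := by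
  have h1 : ∀ g : ι → ℝ, ENNReal.ofReal (∑ i, d i * g i ^ 2) =
      ∑ i, ENNReal.ofReal (d i) * ENNReal.ofReal (g i ^ 2) := fun g => by
    rw [ENNReal.ofReal_sum_of_nonneg fun i _ => mul_nonneg (hd i) (sq_nonneg _)]
    exact Finset.sum_congr rfl fun i _ => ENNReal.ofReal_mul (hd i)
  simp only [h1]
  rw [lintegral_finsetSum _ fun i _ => by fun_prop,
    ENNReal.ofReal_sum_of_nonneg fun i _ => hd i]
  refine Finset.sum_congr rfl fun i _ => ?_
  rw [lintegral_const_mul _ (by fun_prop)]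
  have h2 := (measurePreserving_eval (fun _ : ι => gaussianReal 0 1) i).lintegral_comp
    (f := fun z => ENNReal.ofReal (z ^ 2)) (by fun_prop)
  rw [lintegral_sq_gaussianReal] at h2
  exact (congrArg _ h2).trans (mul_one _)

lemma lintegral_surrogate_le [Nonempty κ] {d : ι → ℝ} (hd : ∀ i, 0 ≤ d i) {F : ℝ}
    (hF : ∑ i, d i ≤ F) :
    ∫⁻ ω, ∫⁻ g, ENNReal.ofReal ((∑ i, d i * g i ^ 2) / (ω ⬝ᵥ ω + ∑ i, d i * g i ^ 2))
        ∂stdNormal ι ∂stdNormal κ ≤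
      ∫⁻ ω, ENNReal.ofReal (F / (ω ⬝ᵥ ω + F)) ∂stdNormal κ := by
  refine lintegral_mono_ae ((ae_dotProduct_self_pos κ).mono fun ω hω => ?_)
  refine lintegral_div_add_le (by fun_prop) (ae_of_all _ fun g =>
    Finset.sum_nonneg fun i _ => mul_nonneg (hd i) (sq_nonneg _)) hω
    ((Finset.sum_nonneg fun i _ => hd i).trans hF) ?_
  rw [lintegral_sum_sq_stdNormal hd]
  exact ENNReal.ofReal_le_ofReal hF

/-- The Laplace transform bound for the event `X ≤ c * Y`, with the parameter `θ = 1 / (4 c F)`. -/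
lemma lintegral_exp_surrogate_le {d : ι → ℝ} (hd : ∀ i, 0 ≤ d i) {F c : ℝ} (hF₀ : 0 < F)
    (hF : ∑ i, d i ≤ F) (hc : 0 < c) :
    ∫⁻ ω, ∫⁻ g, ENNReal.ofReal (Real.exp (1 / (4 * c * F) * (c * ∑ i, d i * g i ^ 2 - ω ⬝ᵥ ω)))
        ∂stdNormal ι ∂stdNormal κ ≤
      ENNReal.ofReal (√2 * (2 * c * F) ^ ((Fintype.card κ : ℝ) / 2)) := by
  set θ := 1 / (4 * c * F) with hθ
  have hθ₀ : 0 < θ := by positivity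
  have hle : ∀ i, d i ≤ F := fun i =>
    (Finset.single_le_sum (fun j _ => hd j) (Finset.mem_univ i)).trans hF
  have hcoef : ∀ i, θ * c * d i = d i / (4 * F) := fun i => by rw [hθ]; field_simp
  have hsplit : ∀ (ω : κ → ℝ) (g : ι → ℝ),
      ENNReal.ofReal (Real.exp (θ * (c * ∑ i, d i * g i ^ 2 - ω ⬝ᵥ ω))) =
        ENNReal.ofReal (Real.exp (-(θ * (ω ⬝ᵥ ω)))) *
          ENNReal.ofReal (Real.exp (∑ i, d i / (4 * F) * g i ^ 2)) := fun ω g => by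
    rw [← ENNReal.ofReal_mul (Real.exp_pos _).le, ← Real.exp_add]
    have : ∑ i, d i / (4 * F) * g i ^ 2 = θ * (c * ∑ i, d i * g i ^ 2) := by
      rw [← mul_assoc, Finset.mul_sum]
      exact Finset.sum_congr rfl fun i _ => by rw [← hcoef]; ring
    rw [this]
    congr 2
    ring
  simp only [hsplit]
  have hω : Measurable fun ω : κ → ℝ => ENNReal.ofReal (Real.exp (-(θ * (ω ⬝ᵥ ω)))) := by
    have := measurable_dotProduct_self (κ := κ)
    fun_prop
  simp only [lintegral_const_mul' _ _ ENNReal.ofReal_ne_top]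
  rw [lintegral_mul_const _ hω, lintegral_exp_neg_mul_dotProduct hθ₀.le,
    lintegral_exp_sum_sq_stdNormal fun i => by
      rw [div_lt_iff₀ (by positivity)]; linarith [hle i],
    ← ENNReal.ofReal_mul (by positivity)]
  apply ENNReal.ofReal_le_ofReal
  rw [mul_comm √2]
  gcongr ?_ * ?_
  · have h1 : 1 / √(1 + 2 * θ) ≤ √(2 * c * F) := by
      rw [div_le_iff₀ (Real.sqrt_pos.2 (by linarith)), ← Real.sqrt_mul (by positivity),
        Real.one_le_sqrt]
      have : 2 * c * F * (1 + 2 * θ) = 2 * c * F + 1 := by rw [hθ]; field_simp; ring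
      rw [this]
      have : 0 < 2 * c * F := by positivity
      linarith
    calc (1 / √(1 + 2 * θ)) ^ Fintype.card κ ≤ √(2 * c * F) ^ Fintype.card κ := by gcongr
      _ = (2 * c * F) ^ ((Fintype.card κ : ℝ) / 2) := by
        rw [Real.sqrt_eq_rpow, ← Real.rpow_natCast, ← Real.rpow_mul (by positivity)]
        congr 1
        ring
  · have h2 : ∏ i, 1 / √(1 - 2 * (d i / (4 * F))) = 1 / √(∏ i, (1 - 2 * (d i / (4 * F)))) := by
      rw [Real.sqrt_prod _ fun i _ => by
        rw [sub_nonneg, ← mul_div_assoc, div_le_one (by positivity)]; linarith [hle i]]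
      simp
    have h3 : 1 / 2 ≤ ∏ i, (1 - 2 * (d i / (4 * F))) := by
      refine le_trans ?_ (one_sub_sum_le_prod_one_sub Finset.univ _ (fun i _ => ?_) fun i _ => ?_)
      · rw [← Finset.mul_sum, ← Finset.sum_div]
        have : (∑ i, d i) / (4 * F) ≤ 1 / 4 := by
          rw [div_le_iff₀ (by positivity)]; linarith
        linarith
      · have := hd i; positivity
      · rw [← mul_div_assoc, div_le_one (by positivity)]; linarith [hle i]
    rw [h2, div_le_iff₀ (Real.sqrt_pos.2 (by linarith)), ← Real.sqrt_mul (by norm_num),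
      Real.one_le_sqrt]
    linarith

end Surrogate

/-! ### Coordinates in an eigenbasis -/

variable {n ℓ : ℕ} {A : Matrix (Fin n) (Fin n) ℝ}

/-- The `i`-th coordinate of a vector in the eigenbasis of a symmetric matrix. -/
noncomputable def eigCoord (hA : A.IsHermitian) (i : Fin n) (v : Fin n → ℝ) : ℝ :=
  hA.eigenvectorBasis i ⬝ᵥ v

lemma dotProduct_eq_sum_eigCoord (hA : A.IsHermitian) (v w : Fin n → ℝ) :
    v ⬝ᵥ w = ∑ i, eigCoord hA i v * eigCoord hA i w := by
  have h := hA.eigenvectorBasis.sum_inner_mul_inner (WithLp.toLp 2 v) (WithLp.toLp 2 w)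
  simp only [PiLp.inner_apply, RCLike.inner_apply, conj_trivial] at h
  simp only [eigCoord, dotProduct]
  rw [Finset.sum_congr rfl fun i _ => mul_comm (v i) (w i), ← h]
  refine Finset.sum_congr rfl fun i _ => ?_
  congr 1
  exact Finset.sum_congr rfl fun j _ => mul_comm _ _

lemma eigCoord_mulVec (hA : A.IsHermitian) (i : Fin n) (v : Fin n → ℝ) :
    eigCoord hA i (A.mulVec v) = hA.eigenvalues i * eigCoord hA i v := by
  have hT : A.transpose = A := by simpa using hA.eq
  rw [eigCoord, eigCoord, Matrix.dotProduct_mulVec, ← Matrix.mulVec_transpose, hT,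
    hA.mulVec_eigenvectorBasis, smul_dotProduct, smul_eq_mul]

open Polynomial in
lemma eigCoord_aeval_mulVec (hA : A.IsHermitian) (p : ℝ[X]) (i : Fin n) (v : Fin n → ℝ) :
    eigCoord hA i ((aeval A p).mulVec v) = p.eval (hA.eigenvalues i) * eigCoord hA i v := by
  induction p using Polynomial.induction_on' generalizing v with
  | add p r hp hr =>
    rw [map_add, Matrix.add_mulVec, eval_add, add_mul, ← hp, ← hr, eigCoord, dotProduct_add]
    rfl
  | monomial k c =>
    have hk : ∀ w, eigCoord hA i ((A ^ k).mulVec w) = hA.eigenvalues i ^ k * eigCoord hA i w := by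
      induction k with
      | zero => simp
      | succ k ih =>
        intro w
        rw [pow_succ, ← Matrix.mulVec_mulVec, ih, eigCoord_mulVec, pow_succ, mul_assoc]
    rw [aeval_monomial, eval_monomial, Algebra.algebraMap_eq_smul_one, smul_mul_assoc, one_mul,
      Matrix.smul_mulVec, mul_assoc, ← hk]
    simp [eigCoord]

open Polynomial in
lemma aeval_mulVec_mem_krylovSubspace (B : Matrix (Fin n) (Fin ℓ) ℝ) {q : ℕ} {p : ℝ[X]}
    (hp : p.natDegree ≤ q) (u : Fin ℓ → ℝ) :
    (aeval A p).mulVec (B.mulVec u) ∈ krylovSubspace A B q := by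
  refine ⟨fun kj => p.coeff kj.1 * u kj.2, ?_⟩
  rw [aeval_eq_sum_range' (Nat.lt_succ_of_le hp), Finset.sum_range]
  ext i
  simp only [Matrix.mulVecLin_apply, Matrix.mulVec, dotProduct, krylovMatrix, Matrix.of_apply,
    Fintype.sum_prod_type]
  rw [← dotProduct, ← Matrix.mulVec, Matrix.sum_mulVec, Finset.sum_apply]
  refine Finset.sum_congr rfl fun k _ => ?_
  have h : (fun x => ∑ j, B x j * u j) = B.mulVec u := rfl
  rw [h, Matrix.smul_mulVec, Matrix.mulVec_mulVec, Pi.smul_apply, smul_eq_mul, Matrix.mulVec,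
    dotProduct, Finset.mul_sum]
  exact Finset.sum_congr rfl fun j _ => by ring

lemma eigenvalues_le_eigMax (hA : A.IsHermitian) (i : Fin n) : hA.eigenvalues i ≤ eigMax hA :=
  le_ciSup (Set.finite_range _).bddAbove i

lemma eigMin_le_eigenvalues (hA : A.IsHermitian) (i : Fin n) : eigMin hA ≤ hA.eigenvalues i :=
  ciInf_le (Set.finite_range _).bddBelow i

lemma dotProduct_self_pos {ι : Type*} [Fintype ι] {v : ι → ℝ} (hv : v ≠ 0) : 0 < v ⬝ᵥ v :=
  lt_of_le_of_ne (Finset.sum_nonneg fun _ _ => mul_self_nonneg _)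
    fun h => hv (dotProduct_self_eq_zero.1 h.symm)

lemma rayleigh_le_eigMax (hA : A.IsHermitian) {v : Fin n → ℝ} (hv : v ≠ 0) :
    rayleigh A v ≤ eigMax hA := by
  rw [rayleigh, div_le_iff₀ (dotProduct_self_pos hv), dotProduct_eq_sum_eigCoord hA,
    dotProduct_eq_sum_eigCoord hA, Finset.mul_sum]
  refine Finset.sum_le_sum fun i _ => ?_
  rw [eigCoord_mulVec]
  nlinarith [mul_le_mul_of_nonneg_right (eigenvalues_le_eigMax hA i)
    (mul_self_nonneg (eigCoord hA i v))]

lemma bddAbove_rayleigh (hA : A.IsHermitian) (B : Matrix (Fin n) (Fin ℓ) ℝ) (q : ℕ) :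
    BddAbove {r : ℝ | ∃ v ∈ krylovSubspace A B q, v ≠ 0 ∧ r = rayleigh A v} := by
  refine ⟨eigMax hA, ?_⟩
  rintro r ⟨v, -, hv, rfl⟩
  exact rayleigh_le_eigMax hA hv

lemma rayleigh_le_maxEigEstimate (hA : A.IsHermitian) (B : Matrix (Fin n) (Fin ℓ) ℝ) {q : ℕ}
    {v : Fin n → ℝ} (hv : v ∈ krylovSubspace A B q) (hv₀ : v ≠ 0) :
    rayleigh A v ≤ maxEigEstimate A B q :=
  le_csSup (bddAbove_rayleigh hA B q) ⟨v, hv, hv₀, rfl⟩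

lemma maxEigEstimate_le_eigMax (hA : A.IsHermitian) (B : Matrix (Fin n) (Fin ℓ) ℝ) {q : ℕ}
    {v : Fin n → ℝ} (hv : v ∈ krylovSubspace A B q) (hv₀ : v ≠ 0) :
    maxEigEstimate A B q ≤ eigMax hA := by
  refine csSup_le ⟨_, v, hv, hv₀, rfl⟩ ?_
  rintro r ⟨w, -, hw, rfl⟩
  exact rayleigh_le_eigMax hA hw

/-- Off the set where the Krylov space vanishes, the estimate is a supremum of quotients that are
continuous in the test matrix, hence lower semicontinuous. -/
lemma measurable_maxEigEstimate (hA : A.IsHermitian) (q : ℕ) :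
    Measurable fun M : Fin n → Fin ℓ → ℝ => maxEigEstimate A (Matrix.of M) q := by
  let V : (Fin (q + 1) × Fin ℓ → ℝ) → (Fin n → Fin ℓ → ℝ) → Fin n → ℝ :=
    fun u M => (krylovMatrix A (Matrix.of M) q).mulVec u
  have hV : ∀ u, Continuous (V u) := fun u => by
    refine continuous_pi fun i => ?_
    simp only [V, krylovMatrix, Matrix.mulVec, dotProduct, Matrix.mul_apply, Matrix.of_apply]
    fun_prop
  have hVV : ∀ u, Continuous fun M => V u M ⬝ᵥ V u M := fun u => by
    have := hV u
    unfold dotProduct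
    fun_prop
  have hVAV : ∀ u, Continuous fun M => V u M ⬝ᵥ A.mulVec (V u M) := fun u => by
    have := hV u
    unfold Matrix.mulVec dotProduct
    fun_prop
  refine measurable_of_Ioi fun r => ?_
  have hE : IsOpen {M | ∃ u, 0 < V u M ⬝ᵥ V u M} := by
    simp only [Set.ofPred_exists]
    exact isOpen_iUnion fun u => isOpen_lt continuous_const (hVV u)
  have hO : IsOpen {M | ∃ u, 0 < V u M ⬝ᵥ V u M ∧
      r * (V u M ⬝ᵥ V u M) < V u M ⬝ᵥ A.mulVec (V u M)} := by
    simp only [Set.ofPred_exists]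
    exact isOpen_iUnion fun u => (isOpen_lt continuous_const (hVV u)).inter
      (isOpen_lt (continuous_const.mul (hVV u)) (hVAV u))
  have hmem : ∀ M v, v ∈ krylovSubspace A (Matrix.of M) q ↔ ∃ u, V u M = v := fun M v => Iff.rfl
  have hset : (fun M : Fin n → Fin ℓ → ℝ => maxEigEstimate A (Matrix.of M) q) ⁻¹' Set.Ioi r =
      {M | ∃ u, 0 < V u M ⬝ᵥ V u M ∧ r * (V u M ⬝ᵥ V u M) < V u M ⬝ᵥ A.mulVec (V u M)} ∪
        ({M | ∃ u, 0 < V u M ⬝ᵥ V u M}ᶜ ∩ {_M | r < 0}) := by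
    ext M
    simp only [Set.mem_preimage, Set.mem_Ioi, Set.mem_union, Set.mem_inter_iff, Set.mem_compl_iff,
      Set.mem_ofPred_eq]
    by_cases hM : ∃ u, 0 < V u M ⬝ᵥ V u M
    · have hne : {r : ℝ | ∃ v ∈ krylovSubspace A (Matrix.of M) q, v ≠ 0 ∧
          r = rayleigh A v}.Nonempty := by
        obtain ⟨u, hu⟩ := hM
        exact ⟨_, V u M, (hmem _ _).2 ⟨u, rfl⟩, fun h => by simp [h] at hu, rfl⟩
      rw [maxEigEstimate, lt_csSup_iff (bddAbove_rayleigh hA _ q) hne]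
      simp only [hM, not_true_eq_false, false_and, or_false]
      constructor
      · rintro ⟨_, ⟨v, hv, hv₀, rfl⟩, hr⟩
        obtain ⟨u, rfl⟩ := (hmem _ _).1 hv
        have hpos := dotProduct_self_pos hv₀
        exact ⟨u, hpos, (lt_div_iff₀ hpos).1 hr⟩
      · rintro ⟨u, hpos, hr⟩
        exact ⟨_, ⟨V u M, (hmem _ _).2 ⟨u, rfl⟩, fun h => by simp [h] at hpos, rfl⟩,
          (lt_div_iff₀ hpos).2 hr⟩
    · have hempty : {r : ℝ | ∃ v ∈ krylovSubspace A (Matrix.of M) q, v ≠ 0 ∧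
          r = rayleigh A v} = ∅ := by
        refine Set.eq_empty_of_forall_notMem ?_
        rintro _ ⟨v, hv, hv₀, rfl⟩
        obtain ⟨u, rfl⟩ := (hmem _ _).1 hv
        exact hM ⟨u, dotProduct_self_pos hv₀⟩
      rw [maxEigEstimate, hempty, Real.sSup_empty]
      simp only [hM, not_false_eq_true, true_and]
      constructor
      · exact fun h => Or.inr h
      · rintro (⟨u, hu, -⟩ | h)
        · exact absurd ⟨u, hu⟩ hM
        · exact h
  rw [hset]
  exact hO.measurableSet.union (hE.measurableSet.compl.inter (MeasurableSet.const _))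

/-! ### The spectral gap and the error of the filtered vector -/

lemma eigMin_lt_eigMax (hA : A.IsHermitian) (hn : 1 ≤ n) (h : eigMax hA ≠ eigMin hA) :
    eigMin hA < eigMax hA :=
  lt_of_le_of_ne ((eigMin_le_eigenvalues hA ⟨0, hn⟩).trans (eigenvalues_le_eigMax hA _)) h.symm

lemma spectralGap_bounds (hA : A.IsHermitian) (hn : 1 ≤ n) (h : eigMax hA ≠ eigMin hA) :
    0 < spectralGap hA ∧ spectralGap hA ≤ 1 ∧ ∀ i, hA.eigenvalues i < eigMax hA →
      (hA.eigenvalues i - eigMin hA) / (eigMax hA - eigMin hA) ≤ 1 - spectralGap hA := by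
  have hlt := eigMin_lt_eigMax hA hn h
  have hR : 0 < eigMax hA - eigMin hA := sub_pos.2 hlt
  have : Nonempty (Fin n) := ⟨⟨0, hn⟩⟩
  obtain ⟨j, hj⟩ := exists_eq_ciInf_of_finite (f := hA.eigenvalues)
  rw [spectralGap, if_neg h]
  set T := {t : ℝ | (∃ i, hA.eigenvalues i = t) ∧ t < eigMax hA} with hT
  have hfin : T.Finite := (Set.finite_range hA.eigenvalues).subset fun t ht => ht.1
  have hjT : eigMin hA ∈ T := ⟨⟨j, hj⟩, hlt⟩
  have hsup := (Set.Nonempty.csSup_mem ⟨_, hjT⟩ hfin).2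
  have hge : ∀ t ∈ T, t ≤ sSup T := fun t ht => le_csSup hfin.bddAbove ht
  refine ⟨div_pos (sub_pos.2 hsup) hR, ?_, fun i hi => ?_⟩
  · rw [div_le_one hR]
    linarith [hge _ hjT]
  · rw [one_sub_div hR.ne', div_le_div_iff_of_pos_right hR]
    linarith [hge _ ⟨⟨i, rfl⟩, hi⟩]

/-- The test vector is `p(A) B ω`, where `ω = M i₀` is the row of eigencoordinates of the columns of
`B` for the eigenvector `i₀` of the largest eigenvalue. -/
lemma relErr_le_of_filter (hA : A.IsHermitian) {i₀ : Fin n} (hi₀ : hA.eigenvalues i₀ = eigMax hA)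
    (hlt : eigMin hA < eigMax hA) (B : Matrix (Fin n) (Fin ℓ) ℝ) {q : ℕ} {p : Polynomial ℝ}
    (hp : p.natDegree ≤ q) (hp₀ : p.eval (eigMax hA) ≠ 0)
    {M : Fin n → Fin ℓ → ℝ} (hM : M = fun i j => eigCoord hA i fun k => B k j)
    (hpos : 0 < M i₀ ⬝ᵥ M i₀) {s : Fin n → ℝ}
    (hs : ∀ i, hA.eigenvalues i < eigMax hA → (p.eval (hA.eigenvalues i)) ^ 2 ≤
      s i * (p.eval (eigMax hA)) ^ 2) (hs₀ : ∀ i, 0 ≤ s i) :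
    0 ≤ relErr hA (maxEigEstimate A B q) ∧
    relErr hA (maxEigEstimate A B q) ≤
      (∑ i, s i * ((M i ⬝ᵥ M i₀) / √(M i₀ ⬝ᵥ M i₀)) ^ 2) /
        (M i₀ ⬝ᵥ M i₀ + ∑ i, s i * ((M i ⬝ᵥ M i₀) / √(M i₀ ⬝ᵥ M i₀)) ^ 2) := by
  set N := M i₀ ⬝ᵥ M i₀ with hN
  set R := eigMax hA - eigMin hA with hR
  have hRpos : 0 < R := sub_pos.2 hlt
  set v := (Polynomial.aeval A p).mulVec (B.mulVec (M i₀)) with hv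
  have hc : ∀ i, eigCoord hA i v = p.eval (hA.eigenvalues i) * (M i ⬝ᵥ M i₀) := fun i => by
    rw [hv, eigCoord_aeval_mulVec]
    congr 1
    rw [eigCoord, Matrix.dotProduct_mulVec]
    congr 1
    ext j
    simp only [hM]
    rfl
  have hvK : v ∈ krylovSubspace A B q := aeval_mulVec_mem_krylovSubspace B hp _
  have hv0 : v ≠ 0 := by
    intro h
    have h1 := hc i₀
    rw [h, eigCoord, dotProduct_zero, hi₀] at h1
    exact (mul_ne_zero hp₀ hpos.ne') h1.symm
  refine ⟨div_nonneg (sub_nonneg.2 (maxEigEstimate_le_eigMax hA B hvK hv0)) hRpos.le, ?_⟩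
  set P := p.eval (eigMax hA) with hP
  have hPpos : 0 < P ^ 2 := by positivity
  set Y := ∑ i, s i * ((M i ⬝ᵥ M i₀) / √N) ^ 2 with hY
  have hY₀ : 0 ≤ Y := Finset.sum_nonneg fun i _ => mul_nonneg (hs₀ i) (sq_nonneg _)
  -- `T` is the squared norm of the part of `v` off the leading eigenspace.
  set T := ∑ i with hA.eigenvalues i < eigMax hA, eigCoord hA i v ^ 2 with hT
  have hT₀ : 0 ≤ T := Finset.sum_nonneg fun i _ => sq_nonneg _
  have hTY : T ≤ P ^ 2 * N * Y := by
    calc T ≤ ∑ i with hA.eigenvalues i < eigMax hA,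
          P ^ 2 * N * (s i * ((M i ⬝ᵥ M i₀) / √N) ^ 2) := by
          refine Finset.sum_le_sum fun i hi => ?_
          rw [hc, mul_pow, div_pow, Real.sq_sqrt hpos.le]
          calc _ ≤ s i * P ^ 2 * (M i ⬝ᵥ M i₀) ^ 2 := by
                exact mul_le_mul_of_nonneg_right (hs i (Finset.mem_filter.1 hi).2) (sq_nonneg _)
            _ = _ := by field_simp
      _ ≤ ∑ i, P ^ 2 * N * (s i * ((M i ⬝ᵥ M i₀) / √N) ^ 2) := by
          refine Finset.sum_le_sum_of_subset_of_nonneg (Finset.filter_subset _ _)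
            fun i _ _ => ?_
          have := hs₀ i
          positivity
      _ = P ^ 2 * N * Y := by rw [hY, Finset.mul_sum]
  have hvv : P ^ 2 * N * N + T ≤ v ⬝ᵥ v := by
    have h1 : P ^ 2 * N * N = eigCoord hA i₀ v ^ 2 := by rw [hc, hi₀]; ring
    have h2 : i₀ ∉ Finset.univ.filter fun i => hA.eigenvalues i < eigMax hA := by simp [hi₀]
    rw [h1, hT, ← Finset.sum_insert (f := fun i => eigCoord hA i v ^ 2) h2,
      dotProduct_eq_sum_eigCoord hA]
    simp only [← sq]
    exact Finset.sum_le_sum_of_subset_of_nonneg (Finset.subset_univ _)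
      fun i _ _ => sq_nonneg _
  have hvpos := dotProduct_self_pos hv0
  have hgap : eigMax hA * (v ⬝ᵥ v) - v ⬝ᵥ A.mulVec v ≤ R * T := by
    rw [dotProduct_eq_sum_eigCoord hA v v, dotProduct_eq_sum_eigCoord hA v, Finset.mul_sum,
      ← Finset.sum_sub_distrib, hT, Finset.mul_sum, Finset.sum_filter]
    refine Finset.sum_le_sum fun i _ => ?_
    rw [eigCoord_mulVec]
    have h1 : eigMax hA * (eigCoord hA i v * eigCoord hA i v) -
        eigCoord hA i v * (hA.eigenvalues i * eigCoord hA i v) =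
          (eigMax hA - hA.eigenvalues i) * eigCoord hA i v ^ 2 := by ring
    rw [h1]
    split_ifs with hi
    · exact mul_le_mul_of_nonneg_right (by linarith [eigMin_le_eigenvalues hA i]) (sq_nonneg _)
    · rw [le_antisymm (eigenvalues_le_eigMax hA i) (not_lt.1 hi)]
      simp
  have hD : 0 < P ^ 2 * N * N := by positivity
  calc relErr hA (maxEigEstimate A B q) ≤ (eigMax hA - rayleigh A v) / R := by
        rw [relErr]
        gcongr
        exact rayleigh_le_maxEigEstimate hA B hvK hv0
    _ ≤ T / (v ⬝ᵥ v) := by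
        rw [rayleigh, div_le_div_iff₀ hRpos hvpos, sub_mul, div_mul_cancel₀ _ hvpos.ne']
        linarith
    _ ≤ T / (P ^ 2 * N * N + T) := by gcongr
    _ ≤ Y / (N + Y) := by
        rw [div_le_div_iff₀ (by positivity) (by positivity)]
        nlinarith [mul_le_mul_of_nonneg_right hTY hpos.le]

/-! ### The error for a random test matrix -/

/-- A largest eigenvalue contributes `1` to the sum. -/
lemma stableRank_pos (hA : A.IsHermitian) (hn : 1 ≤ n) (h : eigMax hA ≠ eigMin hA) (ν : ℝ) :
    0 < stableRank hA ν := by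
  have hR : 0 < eigMax hA - eigMin hA := sub_pos.2 (eigMin_lt_eigMax hA hn h)
  have : Nonempty (Fin n) := ⟨⟨0, hn⟩⟩
  obtain ⟨i, hi⟩ := exists_eq_ciSup_of_finite (f := hA.eigenvalues)
  rw [stableRank, if_neg h]
  refine Finset.sum_pos' (fun j _ => Real.rpow_nonneg (div_nonneg
    (sub_nonneg.2 (eigMin_le_eigenvalues hA j)) hR.le) _) ⟨i, Finset.mem_univ i, ?_⟩
  rw [hi]
  change 0 < ((eigMax hA - eigMin hA) / (eigMax hA - eigMin hA)) ^ (2 * ν)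
  rw [div_self hR.ne', Real.one_rpow]
  exact one_pos

/-- The filter `x ^ q₁ ψ(x)`, with `ψ` the Chebyshev polynomial of degree `q₂` for the interval
`[0, 1 - γ]`, bounds the error by a quotient whose numerator has mean at most `F`. -/
lemma exists_surrogate (hA : A.IsHermitian) (hn : 1 ≤ n) (h : eigMax hA ≠ eigMin hA)
    (q₁ q₂ : ℕ) :
    ∃ (i₀ : Fin n) (d : Fin n → ℝ), (∀ i, 0 ≤ d i) ∧ d i₀ = 0 ∧
      ∑ i, d i ≤ 4 * stableRank hA q₁ * Real.exp (-4 * q₂ * √(spectralGap hA)) ∧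
      ∀ (B : Matrix (Fin n) (Fin ℓ) ℝ) (M : Fin n → Fin ℓ → ℝ),
        (M = fun i j => eigCoord hA i fun k => B k j) → 0 < M i₀ ⬝ᵥ M i₀ →
          0 ≤ relErr hA (maxEigEstimate A B (q₁ + q₂)) ∧
          relErr hA (maxEigEstimate A B (q₁ + q₂)) ≤
            (∑ i, d i * ((M i ⬝ᵥ M i₀) / √(M i₀ ⬝ᵥ M i₀)) ^ 2) /
              (M i₀ ⬝ᵥ M i₀ + ∑ i, d i * ((M i ⬝ᵥ M i₀) / √(M i₀ ⬝ᵥ M i₀)) ^ 2) := by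
  have hlt := eigMin_lt_eigMax hA hn h
  have : Nonempty (Fin n) := ⟨⟨0, hn⟩⟩
  obtain ⟨i₀, hi₀⟩ := exists_eq_ciSup_of_finite (f := hA.eigenvalues)
  change hA.eigenvalues i₀ = eigMax hA at hi₀
  obtain ⟨hγ₀, hγ₁, hγ⟩ := spectralGap_bounds hA hn h
  obtain ⟨ψ, hψdeg, hψle, hψ1⟩ := exists_filter hγ₀ hγ₁ q₂
  set γ := spectralGap hA
  set R := eigMax hA - eigMin hA with hR
  have hRpos : 0 < R := sub_pos.2 hlt
  let b : Fin n → ℝ := fun i => (hA.eigenvalues i - eigMin hA) / R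
  have hb₀ : ∀ i, 0 ≤ b i := fun i =>
    div_nonneg (sub_nonneg.2 (eigMin_le_eigenvalues hA i)) hRpos.le
  set κ := 4 * Real.exp (-4 * q₂ * √γ) with hκ
  have hκ₀ : 0 < κ := by positivity
  have hκψ : 1 ≤ κ * (ψ.eval 1) ^ 2 := by
    have h1 : (Real.exp (2 * q₂ * √γ) / 2) ^ 2 ≤ (ψ.eval 1) ^ 2 :=
      pow_le_pow_left₀ (by positivity) hψ1 2
    have h2 : κ * (Real.exp (2 * q₂ * √γ) / 2) ^ 2 = 1 := by
      have h3 : κ * (Real.exp (2 * q₂ * √γ) / 2) ^ 2 =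
          Real.exp (-4 * q₂ * √γ) * (Real.exp (2 * q₂ * √γ) * Real.exp (2 * q₂ * √γ)) := by
        rw [hκ]; ring
      rw [h3, ← Real.exp_add, ← Real.exp_add]
      ring_nf
      exact Real.exp_zero
    exact h2.ge.trans (mul_le_mul_of_nonneg_left h1 hκ₀.le)
  let L : Polynomial ℝ := Polynomial.C (1 / R) * (Polynomial.X - Polynomial.C (eigMin hA))
  let p : Polynomial ℝ := (Polynomial.X ^ q₁ * ψ).comp L
  have hLdeg : L.natDegree ≤ 1 := by
    simp only [L]
    compute_degree
  have hp : p.natDegree ≤ q₁ + q₂ := by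
    simp only [p]
    rw [Polynomial.natDegree_comp]
    have h1 : (Polynomial.X ^ q₁ * ψ).natDegree ≤ q₁ + q₂ :=
      Polynomial.natDegree_mul_le.trans (by simpa using hψdeg)
    calc _ ≤ (q₁ + q₂) * 1 := Nat.mul_le_mul h1 hLdeg
      _ = q₁ + q₂ := mul_one _
  have hpeval : ∀ x, p.eval x = ((x - eigMin hA) / R) ^ q₁ * ψ.eval ((x - eigMin hA) / R) :=
    fun x => by
      have : L.eval x = (x - eigMin hA) / R := by simp [L]; ring
      simp [p, Polynomial.eval_comp, this]
  have hpmax : p.eval (eigMax hA) = ψ.eval 1 := by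
    rw [hpeval, ← hR, div_self hRpos.ne', one_pow, one_mul]
  have hψpos : 0 < ψ.eval 1 := lt_of_lt_of_le (by positivity) hψ1
  let d : Fin n → ℝ := fun i => if hA.eigenvalues i < eigMax hA then κ * b i ^ (2 * q₁) else 0
  have hd : ∀ i, 0 ≤ d i := fun i => by
    simp only [d]
    have := hb₀ i
    split_ifs <;> positivity
  refine ⟨i₀, d, hd, by simp [d, hi₀], ?_, fun B M hM hpos => ?_⟩
  · rw [stableRank, if_neg h, mul_right_comm, Finset.mul_sum]
    refine Finset.sum_le_sum fun i _ => ?_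
    have h1 : ((hA.eigenvalues i - eigMin hA) / (eigMax hA - eigMin hA)) ^ (2 * (q₁ : ℝ)) =
        b i ^ (2 * q₁) := by
      rw [← Real.rpow_natCast]
      push_cast
      rfl
    rw [h1]
    have h2 : 0 ≤ κ * b i ^ (2 * q₁) := mul_nonneg hκ₀.le (pow_nonneg (hb₀ i) _)
    simp only [d]
    split_ifs
    · exact le_rfl
    · exact h2
  · refine relErr_le_of_filter hA hi₀ hlt B hp (by rw [hpmax]; exact hψpos.ne') hM hpos
      (fun i hi => ?_) hd
    have h1 : (ψ.eval (b i)) ^ 2 ≤ 1 := by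
      rw [sq_le_one_iff_abs_le_one]
      exact hψle _ ⟨hb₀ i, hγ i hi⟩
    have h2 : 0 ≤ b i ^ (2 * q₁) := pow_nonneg (hb₀ i) _
    have h3 : p.eval (hA.eigenvalues i) ^ 2 = b i ^ (2 * q₁) * (ψ.eval (b i)) ^ 2 := by
      rw [hpeval, mul_pow, ← pow_mul, mul_comm q₁ 2]
    simp only [d, if_pos hi]
    rw [hpmax, h3, mul_right_comm, mul_comm (κ * _)]
    exact mul_le_mul_of_nonneg_left (h1.trans hκψ) h2

variable {S : Type*} [MeasurableSpace S] {P : Measure S} [IsProbabilityMeasure P]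
  {W : S → Matrix (Fin n) (Fin ℓ) ℝ}

lemma IsStandardNormal.hasLaw (hW : IsStandardNormal W P) :
    HasLaw (fun s i j => W s i j) (stdNormalMatrix (Fin n) (Fin ℓ)) P :=
  hasLaw_stdNormalMatrix (X := fun i j s => W s i j) hW.indep hW.law

lemma IsStandardNormal.hasLaw_eigCoord (hW : IsStandardNormal W P) (hA : A.IsHermitian) :
    HasLaw (fun s i j => eigCoord hA i fun k => W s k j) (stdNormalMatrix (Fin n) (Fin ℓ)) P := by
  have h := measurePreserving_repr_matrix (κ := Fin ℓ) hA.eigenvectorBasis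
  have hm := h.measurable
  refine ⟨hm.comp_aemeasurable hW.hasLaw.aemeasurable, ?_⟩
  have h2 := h.map_eq
  rw [← hW.hasLaw.map_eq, AEMeasurable.map_map_of_aemeasurable hm.aemeasurable
    hW.hasLaw.aemeasurable] at h2
  exact h2.trans hW.hasLaw.map_eq

lemma IsStandardNormal.aemeasurable_relErr (hW : IsStandardNormal W P) (hA : A.IsHermitian)
    (q : ℕ) : AEMeasurable (fun s => relErr hA (maxEigEstimate A (W s) q)) P := by
  have h := (measurable_maxEigEstimate hA q (ℓ := ℓ)).comp_aemeasurable hW.hasLaw.aemeasurable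
  exact (h.const_sub (eigMax hA)).div_const _

/-- The mean of a function of the surrogate variables, computed for the random matrix itself. -/
lemma IsStandardNormal.lintegral_pairings (hW : IsStandardNormal W P) (hA : A.IsHermitian)
    (hℓ : 1 ≤ ℓ) (i₀ : Fin n) {f : (Fin ℓ → ℝ) → (Fin n → ℝ) → ENNReal}
    (hf : Measurable (Function.uncurry f))
    (hi₀ : ∀ ω g t, f ω (Function.update g i₀ t) = f ω g)
    {M : S → Fin n → Fin ℓ → ℝ} (hM : M = fun s i j => eigCoord hA i fun k => W s k j) :
    ∫⁻ s, f (M s i₀) (fun i => (M s i ⬝ᵥ M s i₀) / √(M s i₀ ⬝ᵥ M s i₀)) ∂P =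
      ∫⁻ ω, ∫⁻ g, f ω g ∂stdNormal (Fin n) ∂stdNormal (Fin ℓ) := by
  have : Nonempty (Fin ℓ) := ⟨⟨0, hℓ⟩⟩
  have hlaw : HasLaw M (stdNormalMatrix (Fin n) (Fin ℓ)) P := hM ▸ hW.hasLaw_eigCoord hA
  rw [← BlockKrylov.lintegral_pairings i₀ hf hi₀, ← hlaw.map_eq, lintegral_map' _ hlaw.aemeasurable]
  refine (hf.comp (f := fun M : Fin n → Fin ℓ → ℝ =>
    (M i₀, fun i => (M i ⬝ᵥ M i₀) / √(M i₀ ⬝ᵥ M i₀))) ?_).aemeasurable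
  unfold dotProduct
  fun_prop

lemma IsStandardNormal.ae_pos (hW : IsStandardNormal W P) (hA : A.IsHermitian) (hℓ : 1 ≤ ℓ)
    (i₀ : Fin n) {M : S → Fin n → Fin ℓ → ℝ}
    (hM : M = fun s i j => eigCoord hA i fun k => W s k j) :
    ∀ᵐ s ∂P, 0 < M s i₀ ⬝ᵥ M s i₀ := by
  have : Nonempty (Fin ℓ) := ⟨⟨0, hℓ⟩⟩
  have hlaw : HasLaw M (stdNormalMatrix (Fin n) (Fin ℓ)) P := hM ▸ hW.hasLaw_eigCoord hA
  have h := (measurePreserving_eval (fun _ : Fin n => stdNormal (Fin ℓ))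
    i₀).quasiMeasurePreserving.ae (ae_dotProduct_self_pos (Fin ℓ))
  refine ae_of_ae_map (p := fun M' => 0 < M' i₀ ⬝ᵥ M' i₀) hlaw.aemeasurable ?_
  rw [hlaw.map_eq]
  exact h

/-- The tail bound, the range of the error, and the comparison of its mean with the chi-squared
distribution, for a matrix that is not a multiple of the identity. -/
lemma relErr_bounds (hn : 1 ≤ n) (hℓ : 1 ≤ ℓ) (hA : A.IsHermitian)
    (h : eigMax hA ≠ eigMin hA) (hW : IsStandardNormal W P) (q₁ q₂ : ℕ)
    {F : ℝ} (hF : F = 4 * stableRank hA q₁ * Real.exp (-4 * q₂ * √(spectralGap hA)))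
    {err : S → ℝ} (herr : err = fun s => relErr hA (maxEigEstimate A (W s) (q₁ + q₂))) :
    0 < F ∧ (∀ᵐ s ∂P, 0 ≤ err s ∧ err s ≤ 1) ∧
    (∀ ε : ℝ, 0 < ε → P.real {s | ε ≤ err s} ≤ √2 * (2 * (1 / ε) * F) ^ ((ℓ : ℝ) / 2)) ∧
    ∫⁻ s, ENNReal.ofReal (err s) ∂P ≤
      ∫⁻ ω, ENNReal.ofReal (F / (ω ⬝ᵥ ω + F)) ∂stdNormal (Fin ℓ) := by
  have : Nonempty (Fin ℓ) := ⟨⟨0, hℓ⟩⟩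
  have hF₀ : 0 < F := by
    have := stableRank_pos hA hn h q₁
    rw [hF]; positivity
  obtain ⟨i₀, d, hd, hdi₀, hdF, hsur⟩ := exists_surrogate (ℓ := ℓ) hA hn h q₁ q₂
  rw [← hF] at hdF
  set M : S → Fin n → Fin ℓ → ℝ := fun s i j => eigCoord hA i fun k => W s k j with hM
  have hpos := hW.ae_pos hA hℓ i₀ hM
  have hY₀ : ∀ g : Fin n → ℝ, 0 ≤ ∑ i, d i * g i ^ 2 := fun g =>
    Finset.sum_nonneg fun i _ => mul_nonneg (hd i) (sq_nonneg _)
  have hupd : ∀ (g : Fin n → ℝ) (t : ℝ),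
      ∑ i, d i * Function.update g i₀ t i ^ 2 = ∑ i, d i * g i ^ 2 := fun g t => by
    refine Finset.sum_congr rfl fun i _ => ?_
    rcases eq_or_ne i i₀ with rfl | hi
    · simp [hdi₀]
    · rw [Function.update_of_ne hi]
  have hdot : Measurable fun x : (Fin ℓ → ℝ) × (Fin n → ℝ) => x.1 ⬝ᵥ x.1 :=
    measurable_dotProduct_self.comp measurable_fst
  subst herr
  refine ⟨hF₀, hpos.mono fun s hs => ?_, fun ε hε => ?_, ?_⟩
  · obtain ⟨h1, h2⟩ := hsur (W s) (M s) rfl hs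
    refine ⟨h1, h2.trans (div_le_one_of_le₀ ?_ ?_)⟩
    · exact le_add_of_nonneg_left hs.le
    · exact add_nonneg hs.le (hY₀ _)
  · have hc : 0 < 1 / ε := by positivity
    let f : (Fin ℓ → ℝ) → (Fin n → ℝ) → ENNReal := fun ω g => ENNReal.ofReal
      (Real.exp (1 / (4 * (1 / ε) * F) * (1 / ε * ∑ i, d i * g i ^ 2 - ω ⬝ᵥ ω)))
    have hf : Measurable (Function.uncurry f) := by
      simp only [f, Function.uncurry_def]
      fun_prop
    have hL := lintegral_exp_surrogate_le (κ := Fin ℓ) hd hF₀ hdF hc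
    rw [Fintype.card_fin] at hL
    have hpair := hW.lintegral_pairings hA hℓ i₀ hf (fun ω g t => by simp only [f, hupd]) hM
    refine ENNReal.toReal_le_of_le_ofReal (by positivity) (le_trans ?_ (hpair.trans_le hL))
    have hnull : NullMeasurableSet
        {s | ε ≤ relErr hA (maxEigEstimate A (W s) (q₁ + q₂))} P :=
      nullMeasurableSet_le aemeasurable_const (hW.aemeasurable_relErr hA _)
    rw [← lintegral_indicator_one₀ hnull]
    refine lintegral_mono_ae (hpos.mono fun s hs => ?_)
    by_cases hmem : s ∈ {s | ε ≤ relErr hA (maxEigEstimate A (W s) (q₁ + q₂))}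
    · rw [Set.indicator_of_mem hmem, Pi.one_apply, ← ENNReal.ofReal_one]
      simp only [f]
      refine ENNReal.ofReal_le_ofReal (Real.one_le_exp (mul_nonneg (by positivity) ?_))
      have h3 : ε ≤ _ := le_trans hmem (hsur (W s) (M s) rfl hs).2
      set Y := ∑ i, d i * ((M s i ⬝ᵥ M s i₀) / √(M s i₀ ⬝ᵥ M s i₀)) ^ 2 with hY
      have hYn : 0 ≤ Y := hY₀ _
      rw [le_div_iff₀ (by positivity)] at h3
      rw [one_div_mul_eq_div, sub_nonneg, le_div_iff₀ hε]
      nlinarith [mul_nonneg hε.le hYn]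
    · rw [Set.indicator_of_notMem hmem]
      exact zero_le
  · let f : (Fin ℓ → ℝ) → (Fin n → ℝ) → ENNReal := fun ω g => ENNReal.ofReal
      ((∑ i, d i * g i ^ 2) / (ω ⬝ᵥ ω + ∑ i, d i * g i ^ 2))
    have hf : Measurable (Function.uncurry f) := by
      simp only [f, Function.uncurry_def]
      fun_prop
    have hpair := hW.lintegral_pairings hA hℓ i₀ hf (fun ω g t => by simp only [f, hupd]) hM
    refine le_trans ?_ (hpair.trans_le (lintegral_surrogate_le hd hdF))
    exact lintegral_mono_ae (hpos.mono fun s hs =>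
      ENNReal.ofReal_le_ofReal (hsur (W s) (M s) rfl hs).2)

lemma relErr_eq_zero (hA : A.IsHermitian) (h : eigMax hA = eigMin hA) (ξ : ℝ) :
    relErr hA ξ = 0 := by
  rw [relErr, h, sub_self, div_zero]

end BlockKrylov

theorem theorem2 {S : Type*} [MeasurableSpace S] (P : Measure S) [IsProbabilityMeasure P]
    (n ℓ : ℕ) (hn : 1 ≤ n) (hℓ : 1 ≤ ℓ)
    (A : Matrix (Fin n) (Fin n) ℝ) (hA : A.IsHermitian)
    (W : S → Matrix (Fin n) (Fin ℓ) ℝ) (hW : BlockKrylov.IsStandardNormal W P)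
    (q q₁ q₂ : ℕ) (hq : q = q₁ + q₂)
    (γ : ℝ) (hγ : γ = BlockKrylov.spectralGap hA)
    (F : ℝ) (hF : F = 4 * BlockKrylov.stableRank hA q₁ * Real.exp (-4 * q₂ * √γ))
    (err : S → ℝ)
    (herr : err = fun s => BlockKrylov.relErr hA (BlockKrylov.maxEigEstimate A (W s) q)) :
    (∀ ε : ℝ, 0 < ε → ε ≤ 1 →
      P.real {s | ε ≤ err s} ≤
        min 1 (√2 * (8 * BlockKrylov.stableRank hA q₁ / ε * Real.exp (-4 * q₂ * √γ))
          ^ ((ℓ : ℝ) / 2))) ∧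
    Integrable err P ∧
    (3 ≤ ℓ → ∫ s, err s ∂P ≤ F / (((ℓ : ℝ) - 2) + F)) ∧
    (ℓ = 2 → ∫ s, err s ∂P ≤ F / 2 * Real.log (1 + 2 / F)) ∧
    (ℓ = 1 → ∫ s, err s ∂P ≤ min 1 √(2 * Real.pi * F)) := by
  open BlockKrylov in
  have hbase : ∀ ε, 8 * stableRank hA q₁ / ε * Real.exp (-4 * q₂ * √γ) = 2 * (1 / ε) * F :=
    fun ε => by rw [hF]; ring
  simp only [hbase]
  subst hq hγ
  by_cases h : eigMax hA = eigMin hA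
  · have herr0 : err = fun _ => 0 := by
      rw [herr]
      exact funext fun s => relErr_eq_zero hA h _
    have hF0 : F = 0 := by rw [hF, stableRank, if_pos h]; ring
    subst herr0 hF0
    refine ⟨fun ε hε _ => ?_, integrable_zero _ _ _, ?_, ?_, ?_⟩
    · have : {s : S | ε ≤ 0} = ∅ :=
        Set.eq_empty_of_forall_notMem fun s hs => hε.not_ge hs
      rw [this, measureReal_empty]
      positivity
    all_goals simp
  · obtain ⟨hF₀, hrange, htail, hmean⟩ := relErr_bounds hn hℓ hA h hW q₁ q₂ hF herr
    have hmeas : AEMeasurable err P := herr ▸ hW.aemeasurable_relErr hA (q₁ + q₂)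
    have hint : Integrable err P :=
      Integrable.of_mem_Icc 0 1 hmeas (hrange.mono fun s hs => ⟨hs.1, hs.2⟩)
    have hexp : ∀ c : ℝ, 0 ≤ c →
        ∫⁻ ω, ENNReal.ofReal (F / (ω ⬝ᵥ ω + F)) ∂stdNormal (Fin ℓ) ≤ ENNReal.ofReal c →
          ∫ s, err s ∂P ≤ c := fun c hc hle => by
      rw [integral_eq_lintegral_of_nonneg_ae (hrange.mono fun s hs => hs.1)
        hmeas.aestronglyMeasurable]
      exact ENNReal.toReal_le_of_le_ofReal hc (hmean.trans hle)
    refine ⟨fun ε hε _ => le_min measureReal_le_one (htail ε hε), hint, fun h3 => ?_, fun h2 => ?_,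
      fun h1 => le_min ?_ ?_⟩
    · have h3' : (3 : ℝ) ≤ ℓ := by exact_mod_cast h3
      refine hexp _ (div_nonneg hF₀.le (by linarith)) ?_
      simpa using lintegral_chiSq_of_three_le (κ := Fin ℓ) (by simpa using h3) hF₀
    · refine hexp _ (mul_nonneg (by positivity) (Real.log_nonneg ?_))
        (lintegral_chiSq_two (by simpa using h2) hF₀)
      have : 0 < 2 / F := by positivity
      linarith
    · calc ∫ s, err s ∂P ≤ ∫ _, (1 : ℝ) ∂P :=
            integral_mono_ae hint (integrable_const _) (hrange.mono fun s hs => hs.2)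
        _ = 1 := by simp
    · exact hexp _ (Real.sqrt_nonneg _) (lintegral_chiSq_one (by simpa using h1) hF₀)
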